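/- **Soundness of the encoding of functional EPTSs in Dedukti with internalized sorts.** *Source system.* Let $\mathcal S$ be a set of sorts with functional relations $\mathcal A\subseteq\mathcal S^2$, $\mathcal R\subseteq\mathcal S^3$ (each $s_1$ has at most one $s_2$ with $(s_1,s_2)\in\mathcal A$, each $(s_1,s_2)$ at most one $s_3$ with $(s_1,s_2,s_3)\in\mathcal R$; total functions $\mathcal A:\mathcal S\to\mathcal S$, $\mathcal R:\mathcal S\times\mathcal S\to\mathcal S$ are a special case). The associated explicitly-typed pure type system (EPTS) has the terms $x \mid s \mid \Pi_{s_1,s_2}(A,[x]B) \mid \lambda_{s_1,s_2}(A,[x]B,[x]M) \mid @_{s_1,s_2}(A,[x]B,M,N)$; reduction is the context closure of $@_{s_1,s_2}(A,[x]B,\lambda_{s_1,s_2}(A',[x]B',[x]M),N)\hookrightarrow M\{N/x\}$ for $(s_1,s_2,s_3)\in\mathcal R$, and $\equiv$ is the equivalence relation it generates. Contexts and typing are given by the usual rules: the empty context is well-formed; $\Gamma,x:A$ is well-formed if $\Gamma\vdash A:s$; for well-formed $\Gamma$, $\Gamma\vdash x:A$ if $x:A\in\Gamma$ and $\Gamma\vdash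 s_1:s_2$ if $(s_1,s_2)\in\mathcal A$; $\Gamma\vdash M:B$ if $\Gamma\vdash M:A$, $\Gamma\vdash B:s$ and $A\equiv B$; and if $(s_1,s_2,s_3)\in\mathcal R$, $\Gamma\vdash A:s_1$ and $\Gamma,x:A\vdash B:s_2$, then $\Gamma\vdash\Pi_{s_1,s_2}(A,[x]B):s_3$; $\Gamma\vdash\lambda_{s_1,s_2}(A,[x]B,[x]M):\Pi_{s_1,s_2}(A,[x]B)$ when $\Gamma,x:A\vdash M:B$; and $\Gamma\vdash @_{s_1,s_2}(A,[x]B,M,N):B\{N/x\}$ when $\Gamma\vdash M:\Pi_{s_1,s_2}(A,[x]B)$ and $\Gamma\vdash N:A$. A *top-sort* is an $s$ with no $s'$ such that $(s,s')\in\mathcal A$. *Target theory.* Dedukti is the $\lambda\Pi$-calculus (sorts $\mathtt{TYPE}$, $\mathtt{KIND}$) with constants $c[\vec M]$ of fixed arity declared in a signature by entries $c[\Delta]:A$, and with conversion generated by $\beta$ and a set of rewrite rules. Let $(\Sigma,\mathscr R)$ be a Dedukti theory that contains the declarations $$\hat{\mathcal S}:\mathtt{TYPE},\quad \hat{\mathcal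 A}[s_1:\hat{\mathcal S}]:\hat{\mathcal S},\quad \hat{\mathcal R}[s_1:\hat{\mathcal S};s_2:\hat{\mathcal S}]:\hat{\mathcal S},\quad \mathbf U[s:\hat{\mathcal S}]:\mathtt{TYPE},\quad \mathbf{El}[s:\hat{\mathcal S};A:\mathbf U\,s]:\mathtt{TYPE},\quad \mathbf u[s:\hat{\mathcal S}]:\mathbf U(\hat{\mathcal A}\,s),$$ $$\mathbf{Prod}[s_1,s_2:\hat{\mathcal S};A:\mathbf U\,s_1;B:\mathbf{El}\,s_1\,A\to\mathbf U\,s_2]:\mathbf U(\hat{\mathcal R}\,s_1\,s_2),$$ $$\mathbf{abs}[s_1,s_2:\hat{\mathcal S};A:\mathbf U\,s_1;B:\mathbf{El}\,s_1\,A\to\mathbf U\,s_2;N:\Pi x:\mathbf{El}\,s_1\,A.\,\mathbf{El}\,s_2(B\,x)]:\mathbf{El}(\hat{\mathcal R}\,s_1\,s_2)(\mathbf{Prod}\,s_1\,s_2\,A\,B),$$ $$\mathbf{app}[s_1,s_2:\hat{\mathcal S};A:\mathbf U\,s_1;B:\mathbf{El}\,s_1\,A\to\mathbf U\,s_2;M:\mathbf{El}(\hat{\mathcal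 R}\,s_1\,s_2)(\mathbf{Prod}\,s_1\,s_2\,A\,B);N:\mathbf{El}\,s_1\,A]:\mathbf{El}\,s_2(B\,N)$$ and the rules $$\mathbf{El}\,s'\,(\mathbf u\,s)\hookrightarrow\mathbf U\,s,\qquad \mathbf{app}\,s_1\,s_2\,A\,B\,(\mathbf{abs}\,s_1'\,s_2'\,A'\,B'\,M)\,N\hookrightarrow M\,N,$$ possibly together with further constants, declarations and rules. Suppose that every sort $s\in\mathcal S$ has a representation $\dot s$, a term with $\vdash\dot s:\hat{\mathcal S}$ in the empty context, such that $\hat{\mathcal A}\,\dot s_1\equiv\dot s_2$ whenever $(s_1,s_2)\in\mathcal A$ and $\hat{\mathcal R}\,\dot s_1\,\dot s_2\equiv\dot s_3$ whenever $(s_1,s_2,s_3)\in\mathcal R$. Write $\vdash_2$ for typing in this theory. *Translation.* Define $[\![x]\!]_S=x$, $[\![s]\!]_S=\mathbf u\,\dot s$, and, with $\bar X=\lambda x:\mathbf{El}\,\dot s_1\,[\![A]\!]_S.\,[\![X]\!]_S$, $$[\![\Pi_{s_1,s_2}(A,[x]B)]\!]_S=\mathbf{Prod}\,\dot s_1\,\dot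 s_2\,[\![A]\!]_S\,\bar B,\quad [\![\lambda_{s_1,s_2}(A,[x]B,[x]M)]\!]_S=\mathbf{abs}\,\dot s_1\,\dot s_2\,[\![A]\!]_S\,\bar B\,\bar M,$$ $$[\![@_{s_1,s_2}(A,[x]B,M,N)]\!]_S=\mathbf{app}\,\dot s_1\,\dot s_2\,[\![A]\!]_S\,\bar B\,[\![M]\!]_S\,[\![N]\!]_S;$$ on well-formed contexts, $[\![-]\!]_S=-$ and $[\![\Gamma,x:A]\!]_S=[\![\Gamma]\!]_S,\,x:\mathbf{El}\,\dot s_A\,[\![A]\!]_S$, where $s_A$ is the unique sort with $\Gamma\vdash A:s_A$. **Corollary.** Let $\Gamma$ be a context and $M,A$ terms of the EPTS. 1. If $\Gamma$ is well-formed, then $[\![\Gamma]\!]_S$ is well-formed in $(\Sigma,\mathscr R)$. 2. If $\Gamma\vdash M:A$, then - if $A=s$ is a top-sort, then $[\![\Gamma]\!]_S\vdash_2[\![M]\!]_S:\mathbf U\,\dot s$; - otherwise there is a unique sort $s_A$ with $\Gamma\vdash A:s_A$, and $[\![\Gamma]\!]_S\vdash_2[\![M]\!]_S:\mathbf{El}\,\dot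 s_A\,[\![A]\!]_S$. -/

import Mathlib

universe u v

/-! ## The logical framework Dedukti (with arities)

Terms are in de Bruijn style; contexts are lists whose head is the most recent declaration. -/

namespace DK

/-- Dedukti terms over a type `C` of constants with fixed arities `ar`. -/
inductive Term (C : Type u) (ar : C → ℕ) : Type u
  | var (n : ℕ) : Term C ar
  | const (c : C) (args : Fin (ar c) → Term C ar) : Term C ar
  | type : Term C ar
  | kind : Term C ar
  | app (M N : Term C ar) : Term C ar
  | lam (A M : Term C ar) : Term C ar
  | pi (A B : Term C ar) : Term C ar

variable {C : Type u} {ar : C → ℕ}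

/-- Lifting of a renaming under one binder. -/
def upRen (ξ : ℕ → ℕ) : ℕ → ℕ
  | 0 => 0
  | n + 1 => ξ n + 1

namespace Term

/-- Renaming of the free variables. -/
def rename : (ℕ → ℕ) → Term C ar → Term C ar
  | ξ, var n => var (ξ n)
  | ξ, const c args => const c (fun i => (args i).rename ξ)
  | _, type => type
  | _, kind => kind
  | ξ, app M N => app (M.rename ξ) (N.rename ξ)
  | ξ, lam A M => lam (A.rename ξ) (M.rename (upRen ξ))
  | ξ, pi A B => pi (A.rename ξ) (B.rename (upRen ξ))

/-- Lifting of a substitution under one binder. -/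
def up (σ : ℕ → Term C ar) : ℕ → Term C ar
  | 0 => var 0
  | n + 1 => (σ n).rename Nat.succ

/-- Simultaneous capture-avoiding substitution. -/
def subst : (ℕ → Term C ar) → Term C ar → Term C ar
  | σ, var n => σ n
  | σ, const c args => const c (fun i => (args i).subst σ)
  | _, type => type
  | _, kind => kind
  | σ, app M N => app (M.subst σ) (N.subst σ)
  | σ, lam A M => lam (A.subst σ) (M.subst (up σ))
  | σ, pi A B => pi (A.subst σ) (B.subst (up σ))

/-- The substitution `{N/x}` for the most recent variable `x`. -/
def single (N : Term C ar) : ℕ → Term C ar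
  | 0 => N
  | n + 1 => var n

/-- The substitution `{M₁/x₁}…{Mₖ/xₖ}` for the `k` most recent variables, where `xₖ` is the most
recent one (de Bruijn index `0`), given the first `k` entries of a vector `M`. -/
def inst {n : ℕ} (M : Fin n → Term C ar) (k : ℕ) (hk : k ≤ n) : ℕ → Term C ar :=
  fun j => if h : j < k then M ⟨k - 1 - j, by omega⟩ else var (j - k)

/-- The sorts of Dedukti: `TYPE` and `KIND`. -/
def IsSort (s : Term C ar) : Prop := s = type ∨ s = kind

end Term

/-- A declaration `c[Δ] : A`. The entry `ctx i` of the context `Δ = x₁ : A₁, …, xₙ : Aₙ` may use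
the variables declared before it, the closest one having de Bruijn index `0`. -/
structure Decl (C : Type u) (ar : C → ℕ) where
  head : C
  ctx : Fin (ar head) → Term C ar
  type : Term C ar

/-- The context `Δ` of a declaration as a Dedukti context. -/
def Decl.ctxList (d : Decl C ar) : List (Term C ar) := (List.ofFn d.ctx).reverse

/-- A rewrite rule `c[l₁,…,lₙ] ↪ r`. -/
structure Rule (C : Type u) (ar : C → ℕ) where
  head : C
  args : Fin (ar head) → Term C ar
  rhs : Term C ar

/-- A signature together with a set of rewrite rules. -/
structure Theory (C : Type u) (ar : C → ℕ) where
  sig : Set (Decl C ar)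
  rules : Set (Rule C ar)

/-- One step of `β` or of a rewrite rule: closure under substitutions and contexts. -/
inductive Step (R : Set (Rule C ar)) : Term C ar → Term C ar → Prop
  | beta (A M N : Term C ar) : Step R (.app (.lam A M) N) (M.subst (Term.single N))
  | rule (r : Rule C ar) (hr : r ∈ R) (σ : ℕ → Term C ar) :
      Step R ((Term.const r.head r.args).subst σ) (r.rhs.subst σ)
  | const (c : C) (args : Fin (ar c) → Term C ar) (i : Fin (ar c)) (M' : Term C ar) :
      Step R (args i) M' → Step R (.const c args) (.const c (Function.update args i M'))
  | appL {M M' : Term C ar} (N : Term C ar) : Step R M M' → Step R (.app M N) (.app M' N)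
  | appR (M : Term C ar) {N N' : Term C ar} : Step R N N' → Step R (.app M N) (.app M N')
  | lamL {A A' : Term C ar} (M : Term C ar) : Step R A A' → Step R (.lam A M) (.lam A' M)
  | lamR (A : Term C ar) {M M' : Term C ar} : Step R M M' → Step R (.lam A M) (.lam A M')
  | piL {A A' : Term C ar} (B : Term C ar) : Step R A A' → Step R (.pi A B) (.pi A' B)
  | piR (A : Term C ar) {B B' : Term C ar} : Step R B B' → Step R (.pi A B) (.pi A B')

/-- Conversion: the equivalence relation generated by `β` and the rewrite rules. -/
def Conv (R : Set (Rule C ar)) : Term C ar → Term C ar → Prop := Relation.EqvGen (Step R)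

mutual

/-- `Σ; Γ well-formed`. -/
inductive WF (T : Theory C ar) : List (Term C ar) → Prop
  | empty : WF T []
  | decl {Γ : List (Term C ar)} {A : Term C ar} : Typed T Γ A .type → WF T (A :: Γ)

/-- `Σ; Γ ⊢ M : A`. -/
inductive Typed (T : Theory C ar) : List (Term C ar) → Term C ar → Term C ar → Prop
  | cons {Γ : List (Term C ar)} {s : Term C ar} (d : Decl C ar) (hd : d ∈ T.sig)
      (M : Fin (ar d.head) → Term C ar) (hs : s.IsSort) :
      WF T Γ →
      Typed T d.ctxList d.type s →
      (∀ i : Fin (ar d.head), Typed T Γ (M i) ((d.ctx i).subst (Term.inst M i i.isLt.le))) →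
      Typed T Γ (.const d.head M) (d.type.subst (Term.inst M (ar d.head) le_rfl))
  | sort {Γ : List (Term C ar)} : WF T Γ → Typed T Γ .type .kind
  | var {Γ : List (Term C ar)} {A : Term C ar} (n : ℕ) : WF T Γ → Γ[n]? = some A →
      Typed T Γ (.var n) (A.rename (fun k => k + (n + 1)))
  | conv {Γ : List (Term C ar)} {M A B s : Term C ar} (hs : s.IsSort) :
      Typed T Γ M A → Typed T Γ B s → Conv T.rules A B → Typed T Γ M B
  | prod {Γ : List (Term C ar)} {A B s : Term C ar} (hs : s.IsSort) :
      Typed T Γ A .type → Typed T (A :: Γ) B s → Typed T Γ (.pi A B) s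
  | app {Γ : List (Term C ar)} {M N A B : Term C ar} :
      Typed T Γ M (.pi A B) → Typed T Γ N A →
      Typed T Γ (.app M N) (B.subst (Term.single N))
  | abs {Γ : List (Term C ar)} {A B M s : Term C ar} (hs : s.IsSort) :
      Typed T Γ A .type → Typed T (A :: Γ) B s → Typed T (A :: Γ) M B →
      Typed T Γ (.lam A M) (.pi A B)

end

end DK

/-! ## Explicitly-typed Pure Type Systems -/

namespace EPTS

/-- The relations `𝒜 ⊆ 𝒮²` and `ℛ ⊆ 𝒮³` of a functional (explicitly-typed) pure type system. -/
structure Spec (S : Type u) where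
  ax : S → S → Prop
  rel : S → S → S → Prop
  ax_functional : ∀ s t t', ax s t → ax s t' → t = t'
  rel_functional : ∀ s₁ s₂ t t', rel s₁ s₂ t → rel s₁ s₂ t' → t = t'

/-- Terms; in `B` and in the body `M` of `lam`, index `0` is bound. -/
inductive Term (S : Type u) : Type u
  | var (n : ℕ) : Term S
  | sort (s : S) : Term S
  | pi (s₁ s₂ : S) (A B : Term S) : Term S
  | lam (s₁ s₂ : S) (A B M : Term S) : Term S
  | app (s₁ s₂ : S) (A B M N : Term S) : Term S

variable {S : Type u}

namespace Term

/-- Renaming of the free variables. -/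
def rename : (ℕ → ℕ) → Term S → Term S
  | ξ, var n => var (ξ n)
  | _, sort s => sort s
  | ξ, pi s₁ s₂ A B => pi s₁ s₂ (A.rename ξ) (B.rename (DK.upRen ξ))
  | ξ, lam s₁ s₂ A B M =>
      lam s₁ s₂ (A.rename ξ) (B.rename (DK.upRen ξ)) (M.rename (DK.upRen ξ))
  | ξ, app s₁ s₂ A B M N =>
      app s₁ s₂ (A.rename ξ) (B.rename (DK.upRen ξ)) (M.rename ξ) (N.rename ξ)

/-- Lifting of a substitution under one binder. -/
def up (σ : ℕ → Term S) : ℕ → Term S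
  | 0 => var 0
  | n + 1 => (σ n).rename Nat.succ

/-- Simultaneous capture-avoiding substitution. -/
def subst : (ℕ → Term S) → Term S → Term S
  | σ, var n => σ n
  | _, sort s => sort s
  | σ, pi s₁ s₂ A B => pi s₁ s₂ (A.subst σ) (B.subst (up σ))
  | σ, lam s₁ s₂ A B M => lam s₁ s₂ (A.subst σ) (B.subst (up σ)) (M.subst (up σ))
  | σ, app s₁ s₂ A B M N => app s₁ s₂ (A.subst σ) (B.subst (up σ)) (M.subst σ) (N.subst σ)

/-- The substitution `{N/x}` for the most recent variable `x`. -/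
def single (N : Term S) : ℕ → Term S
  | 0 => N
  | n + 1 => var n

end Term

/-- A top-sort: a sort `s` with no `s'` such that `(s, s') ∈ 𝒜`. -/
def Spec.IsTop (P : Spec S) (s : S) : Prop := ¬ ∃ s', P.ax s s'

/-- Reduction: context closure of the (linearized) `β` rules. -/
inductive Step (P : Spec S) : Term S → Term S → Prop
  | beta {s₁ s₂ s₃ : S} (A B A' B' M N : Term S) : P.rel s₁ s₂ s₃ →
      Step P (.app s₁ s₂ A B (.lam s₁ s₂ A' B' M) N) (M.subst (Term.single N))
  | pi₁ (s₁ s₂ : S) {A A' : Term S} (B : Term S) : Step P A A' →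
      Step P (.pi s₁ s₂ A B) (.pi s₁ s₂ A' B)
  | pi₂ (s₁ s₂ : S) (A : Term S) {B B' : Term S} : Step P B B' →
      Step P (.pi s₁ s₂ A B) (.pi s₁ s₂ A B')
  | lam₁ (s₁ s₂ : S) {A A' : Term S} (B M : Term S) : Step P A A' →
      Step P (.lam s₁ s₂ A B M) (.lam s₁ s₂ A' B M)
  | lam₂ (s₁ s₂ : S) (A : Term S) {B B' : Term S} (M : Term S) : Step P B B' →
      Step P (.lam s₁ s₂ A B M) (.lam s₁ s₂ A B' M)
  | lam₃ (s₁ s₂ : S) (A B : Term S) {M M' : Term S} : Step P M M' →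
      Step P (.lam s₁ s₂ A B M) (.lam s₁ s₂ A B M')
  | app₁ (s₁ s₂ : S) {A A' : Term S} (B M N : Term S) : Step P A A' →
      Step P (.app s₁ s₂ A B M N) (.app s₁ s₂ A' B M N)
  | app₂ (s₁ s₂ : S) (A : Term S) {B B' : Term S} (M N : Term S) : Step P B B' →
      Step P (.app s₁ s₂ A B M N) (.app s₁ s₂ A B' M N)
  | app₃ (s₁ s₂ : S) (A B : Term S) {M M' : Term S} (N : Term S) : Step P M M' →
      Step P (.app s₁ s₂ A B M N) (.app s₁ s₂ A B M' N)
  | app₄ (s₁ s₂ : S) (A B M : Term S) {N N' : Term S} : Step P N N' →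
      Step P (.app s₁ s₂ A B M N) (.app s₁ s₂ A B M N')

/-- Conversion: the equivalence relation generated by reduction. -/
def Conv (P : Spec S) : Term S → Term S → Prop := Relation.EqvGen (Step P)

mutual

/-- `Γ well-formed`. -/
inductive WF (P : Spec S) : List (Term S) → Prop
  | empty : WF P []
  | decl {Γ : List (Term S)} {A : Term S} {s : S} : Typed P Γ A (.sort s) → WF P (A :: Γ)

/-- `Γ ⊢ M : A`. -/
inductive Typed (P : Spec S) : List (Term S) → Term S → Term S → Prop
  | conv {Γ : List (Term S)} {M A B : Term S} {s : S} :
      Typed P Γ M A → Typed P Γ B (.sort s) → Conv P A B → Typed P Γ M B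
  | sort {Γ : List (Term S)} {s₁ s₂ : S} : WF P Γ → P.ax s₁ s₂ → Typed P Γ (.sort s₁) (.sort s₂)
  | var {Γ : List (Term S)} {A : Term S} (n : ℕ) : WF P Γ → Γ[n]? = some A →
      Typed P Γ (.var n) (A.rename (fun k => k + (n + 1)))
  | prod {Γ : List (Term S)} {A B : Term S} {s₁ s₂ s₃ : S} : P.rel s₁ s₂ s₃ →
      Typed P Γ A (.sort s₁) → Typed P (A :: Γ) B (.sort s₂) →
      Typed P Γ (.pi s₁ s₂ A B) (.sort s₃)
  | abs {Γ : List (Term S)} {A B M : Term S} {s₁ s₂ s₃ : S} : P.rel s₁ s₂ s₃ →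
      Typed P Γ A (.sort s₁) → Typed P (A :: Γ) B (.sort s₂) → Typed P (A :: Γ) M B →
      Typed P Γ (.lam s₁ s₂ A B M) (.pi s₁ s₂ A B)
  | app {Γ : List (Term S)} {A B M N : Term S} {s₁ s₂ s₃ : S} : P.rel s₁ s₂ s₃ →
      Typed P Γ A (.sort s₁) → Typed P (A :: Γ) B (.sort s₂) → Typed P Γ N A →
      Typed P Γ M (.pi s₁ s₂ A B) →
      Typed P Γ (.app s₁ s₂ A B M N) (B.subst (Term.single N))

end

end EPTS

/-! ## The encoding with internalized sorts -/

namespace SEnc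

/-- The constants `Ŝ, Â, R̂, U, El, u, Prod, abs, app`, together with the further constants
`extra k` that a particular sort structure may need (such as `z` and `s` for natural numbers). -/
inductive Const (K : Type v) : Type v
  | sortType
  | axFun
  | relFun
  | univ
  | el
  | code
  | prod
  | abs
  | app
  | extra (k : K)

/-- Arities of the constants, given those of the further constants. -/
def arity {K : Type v} (arK : K → ℕ) : Const K → ℕ
  | .sortType => 0
  | .axFun => 1
  | .relFun => 2
  | .univ => 1
  | .el => 2
  | .code => 1
  | .prod => 4
  | .abs => 5
  | .app => 6
  | .extra k => arK k

/-- Terms of the target of the encoding. -/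
abbrev Tm {K : Type v} (arK : K → ℕ) : Type v := DK.Term (Const K) (arity arK)

variable {K : Type v} {arK : K → ℕ}

/-- `Ŝ` -/
def tS : Tm arK := .const .sortType ![]
/-- `Â s` -/
def tA (s : Tm arK) : Tm arK := .const .axFun ![s]
/-- `R̂ s₁ s₂` -/
def tR (s₁ s₂ : Tm arK) : Tm arK := .const .relFun ![s₁, s₂]
/-- `U s` -/
def tU (s : Tm arK) : Tm arK := .const .univ ![s]
/-- `El s A` -/
def tEl (s A : Tm arK) : Tm arK := .const .el ![s, A]
/-- `u s` -/
def tCode (s : Tm arK) : Tm arK := .const .code ![s]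
/-- `Prod s₁ s₂ A B` -/
def tProd (s₁ s₂ A B : Tm arK) : Tm arK := .const .prod ![s₁, s₂, A, B]
/-- `abs s₁ s₂ A B M` -/
def tAbs (s₁ s₂ A B M : Tm arK) : Tm arK := .const .abs ![s₁, s₂, A, B, M]
/-- `app s₁ s₂ A B M N` -/
def tApp (s₁ s₂ A B M N : Tm arK) : Tm arK := .const .app ![s₁, s₂, A, B, M, N]

open DK.Term in
/-- The signature common to all sort structures (variables are de Bruijn indices). -/
def baseSig (arK : K → ℕ) : Set (DK.Decl (Const K) (arity arK)) :=
  { -- Ŝ : TYPE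
    ⟨.sortType, ![], type⟩,
    -- Â [s₁ : Ŝ] : Ŝ
    ⟨.axFun, ![tS], tS⟩,
    -- R̂ [s₁ : Ŝ; s₂ : Ŝ] : Ŝ
    ⟨.relFun, ![tS, tS], tS⟩,
    -- U [s : Ŝ] : TYPE
    ⟨.univ, ![tS], type⟩,
    -- El [s : Ŝ; A : U s] : TYPE
    ⟨.el, ![tS, tU (var 0)], type⟩,
    -- u [s : Ŝ] : U (Â s)
    ⟨.code, ![tS], tU (tA (var 0))⟩,
    -- Prod [s₁ : Ŝ; s₂ : Ŝ; A : U s₁; B : El s₁ A → U s₂] : U (R̂ s₁ s₂)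
    ⟨.prod, ![tS, tS, tU (var 1), pi (tEl (var 2) (var 0)) (tU (var 2))],
      tU (tR (var 3) (var 2))⟩,
    -- abs [s₁; s₂; A; B; N : Π x : El s₁ A. El s₂ (B x)] : El (R̂ s₁ s₂) (Prod s₁ s₂ A B)
    ⟨.abs, ![tS, tS, tU (var 1), pi (tEl (var 2) (var 0)) (tU (var 2)),
        pi (tEl (var 3) (var 1)) (tEl (var 3) (app (var 1) (var 0)))],
      tEl (tR (var 4) (var 3)) (tProd (var 4) (var 3) (var 2) (var 1))⟩,
    -- app [s₁; s₂; A; B; M : El (R̂ s₁ s₂) (Prod s₁ s₂ A B); N : El s₁ A] : El s₂ (B N)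
    ⟨.app, ![tS, tS, tU (var 1), pi (tEl (var 2) (var 0)) (tU (var 2)),
        tEl (tR (var 3) (var 2)) (tProd (var 3) (var 2) (var 1) (var 0)),
        tEl (var 4) (var 2)],
      tEl (var 4) (app (var 2) (var 0))⟩ }

open DK.Term in
/-- The rewrite rules common to all sort structures. -/
def baseRules (arK : K → ℕ) : Set (DK.Rule (Const K) (arity arK)) :=
  { -- El s' (u s) ↪ U s
    ⟨.el, ![var 0, tCode (var 1)], tU (var 1)⟩,
    -- app s₁ s₂ A B (abs s₁' s₂' A' B' M) N ↪ M N
    ⟨.app, ![var 0, var 1, var 2, var 3, tAbs (var 4) (var 5) (var 6) (var 7) (var 8), var 9],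
      app (var 8) (var 9)⟩ }

variable {S : Type u}

/-- The theory `T` completes the common part of the encoding and, through `dot`, correctly
represents the sort structure `P`: each sort `s` has a closed representation `dot s : Ŝ`, and `Â`
and `R̂` compute the relations of `P` on representations. -/
structure Represents (P : EPTS.Spec S) (T : DK.Theory (Const K) (arity arK))
    (dot : S → Tm arK) : Prop where
  sig_subset : baseSig arK ⊆ T.sig
  rules_subset : baseRules arK ⊆ T.rules
  typed : ∀ s, DK.Typed T [] (dot s) tS
  ax_conv : ∀ s₁ s₂, P.ax s₁ s₂ → DK.Conv T.rules (tA (dot s₁)) (dot s₂)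
  rel_conv : ∀ s₁ s₂ s₃, P.rel s₁ s₂ s₃ →
    DK.Conv T.rules (tR (dot s₁) (dot s₂)) (dot s₃)

/-- The translation `⟦M⟧_S` of terms. -/
def tr (dot : S → Tm arK) : EPTS.Term S → Tm arK
  | .var n => .var n
  | .sort s => tCode (dot s)
  | .pi s₁ s₂ A B =>
      tProd (dot s₁) (dot s₂) (tr dot A) (.lam (tEl (dot s₁) (tr dot A)) (tr dot B))
  | .lam s₁ s₂ A B M =>
      tAbs (dot s₁) (dot s₂) (tr dot A) (.lam (tEl (dot s₁) (tr dot A)) (tr dot B))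
        (.lam (tEl (dot s₁) (tr dot A)) (tr dot M))
  | .app s₁ s₂ A B M N =>
      tApp (dot s₁) (dot s₂) (tr dot A) (.lam (tEl (dot s₁) (tr dot A)) (tr dot B))
        (tr dot M) (tr dot N)

open Classical in
/-- The translation `⟦Γ⟧_S` of well-formed contexts: `⟦Γ, x : A⟧_S = ⟦Γ⟧_S, x : El ṡ_A ⟦A⟧_S`
where `s_A` is the sort with `Γ ⊢ A : s_A` (unique, since the system is functional). Entries
without a sort, which do not occur in well-formed contexts, are dropped. -/
noncomputable def trCtx (P : EPTS.Spec S) (dot : S → Tm arK) : List (EPTS.Term S) → List (Tm arK)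
  | [] => []
  | A :: Γ =>
      if h : ∃ s, EPTS.Typed P Γ A (.sort s) then
        tEl (dot h.choose) (tr dot A) :: trCtx P dot Γ
      else trCtx P dot Γ

end SEnc

-- The target theory may contain arbitrary further rules, so neither confluence nor inversion is
-- available in Dedukti. There, only renaming, substitution and closure of conversion under contexts
-- are used. The real metatheory lives on the source side.
--
-- Source reduction is confluent (`Par.diamond`), which makes products injective and sorts distinct
-- up to conversion. Functionality then gives uniqueness of types (`Typed.conv_unique`), and subject
-- reduction (`Step.typed`) follows. Together they yield `Conv.sort_unique`: convertible well-sorted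
-- terms have the same sort, so the index of `El` does not change along a conversion.
--
-- Since the representations of sorts are closed, the translation commutes with substitution. A
-- source β step is simulated by the rule for `app` and `abs` followed by a Dedukti β step
-- (`tr_step`).
--
-- Soundness is an induction on derivations for the two-sided invariant `SoundJudgment`: type `U ṡ`
-- when the type is a sort `s`, type `El ṡ ⟦A⟧` when `A` has a sort `s`. For a sort that itself has
-- a sort the two agree by `El s' (u s) ↪ U s`. For a top-sort only the first exists, whence the
-- case split in the theorem.

namespace DK

variable {C : Type u} {ar : C → ℕ}

-- Substitution calculus for Dedukti terms

theorem upRen_id : upRen id = id := by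
  funext n; cases n <;> rfl

theorem upRen_comp (ζ ξ : ℕ → ℕ) : upRen (ζ ∘ ξ) = upRen ζ ∘ upRen ξ := by
  funext n; cases n <;> rfl

namespace Term

theorem rename_id (M : Term C ar) : M.rename id = M := by
  induction M <;> simp_all [rename, upRen_id]

/-- The composition laws come in the order renaming-renaming, renaming-substitution,
substitution-renaming, substitution-substitution: lifting a substitution involves a renaming, so the
later laws use the earlier ones under binders. -/
theorem rename_rename (M : Term C ar) (ξ ζ : ℕ → ℕ) :
    (M.rename ξ).rename ζ = M.rename (ζ ∘ ξ) := by
  induction M generalizing ξ ζ <;> simp_all [rename, upRen_comp]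

theorem up_comp_upRen (σ : ℕ → Term C ar) (ξ : ℕ → ℕ) : up (σ ∘ ξ) = up σ ∘ upRen ξ := by
  funext n; cases n <;> rfl

theorem rename_subst (M : Term C ar) (ξ : ℕ → ℕ) (σ : ℕ → Term C ar) :
    (M.rename ξ).subst σ = M.subst (σ ∘ ξ) := by
  induction M generalizing ξ σ <;> simp_all [rename, subst, up_comp_upRen]

theorem up_rename_comp (σ : ℕ → Term C ar) (ξ : ℕ → ℕ) :
    up (fun n => (σ n).rename ξ) = fun n => (up σ n).rename (upRen ξ) := by
  funext n
  cases n with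
  | zero => rfl
  | succ n => simp only [up, rename_rename]; rfl

theorem subst_rename (M : Term C ar) (σ : ℕ → Term C ar) (ξ : ℕ → ℕ) :
    (M.subst σ).rename ξ = M.subst (fun n => (σ n).rename ξ) := by
  induction M generalizing ξ σ <;> simp_all [rename, subst, up_rename_comp]

theorem up_subst_comp (σ τ : ℕ → Term C ar) :
    up (fun n => (σ n).subst τ) = fun n => (up σ n).subst (up τ) := by
  funext n
  cases n with
  | zero => rfl
  | succ n => simp only [up, subst_rename, rename_subst]; rfl

theorem subst_subst (M : Term C ar) (σ τ : ℕ → Term C ar) :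
    (M.subst σ).subst τ = M.subst (fun n => (σ n).subst τ) := by
  induction M generalizing σ τ <;> simp_all [subst, up_subst_comp]

theorem up_var : up (var : ℕ → Term C ar) = var := by
  funext n; cases n <;> rfl

theorem subst_var (M : Term C ar) : M.subst var = M := by
  induction M <;> simp_all [subst, up_var]

theorem rename_eq_subst (M : Term C ar) (ξ : ℕ → ℕ) : M.rename ξ = M.subst (fun n => var (ξ n)) := by
  conv_lhs => rw [← subst_var M, subst_rename]
  rfl

theorem subst_single_subst (M N : Term C ar) (σ : ℕ → Term C ar) :
    (M.subst (single N)).subst σ = (M.subst (up σ)).subst (single (N.subst σ)) := by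
  simp only [subst_subst]
  congr 1
  funext n
  cases n with
  | zero => rfl
  | succ n => simp only [single, up, subst, rename_subst]; exact (subst_var _).symm

theorem subst_single_rename (M N : Term C ar) (ξ : ℕ → ℕ) :
    (M.subst (single N)).rename ξ = (M.rename (upRen ξ)).subst (single (N.rename ξ)) := by
  simp only [subst_rename, rename_subst]
  congr 1
  funext n
  cases n <;> rfl

theorem rename_succ_subst_up (M : Term C ar) (σ : ℕ → Term C ar) :
    (M.rename Nat.succ).subst (up σ) = (M.subst σ).rename Nat.succ := by
  rw [rename_subst, subst_rename]; rfl

theorem rename_succ_subst_single (M N : Term C ar) :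
    (M.rename Nat.succ).subst (single N) = M := by
  rw [rename_subst]; exact subst_var M

theorem rename_add_succ (M : Term C ar) (n : ℕ) :
    M.rename (fun k => k + (n + 1 + 1)) = (M.rename (fun k => k + (n + 1))).rename Nat.succ := by
  rw [rename_rename]; rfl

/-- All free variables are below `k`. -/
def Scoped : ℕ → Term C ar → Prop
  | k, var n => n < k
  | k, const _ args => ∀ i, (args i).Scoped k
  | _, type => True
  | _, kind => True
  | k, app M N => M.Scoped k ∧ N.Scoped k
  | k, lam A M => A.Scoped k ∧ M.Scoped (k + 1)
  | k, pi A B => A.Scoped k ∧ B.Scoped (k + 1)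

theorem up_congr {k : ℕ} {σ τ : ℕ → Term C ar} (h : ∀ j < k, σ j = τ j) :
    ∀ j < k + 1, up σ j = up τ j := by
  rintro (_ | j) hj
  · rfl
  · simp [up, h j (by omega)]

theorem Scoped.subst_congr {M : Term C ar} {k : ℕ} (hM : M.Scoped k) {σ τ : ℕ → Term C ar}
    (h : ∀ j < k, σ j = τ j) : M.subst σ = M.subst τ := by
  induction M generalizing k σ τ with
  | var n => exact h n hM
  | const c args ih => simp only [subst]; congr 1; funext i; exact ih i (hM i) h
  | type => rfl
  | kind => rfl
  | app M N ih₁ ih₂ => simp only [subst, ih₁ hM.1 h, ih₂ hM.2 h]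
  | lam M N ih₁ ih₂ => simp only [subst, ih₁ hM.1 h, ih₂ hM.2 (up_congr h)]
  | pi M N ih₁ ih₂ => simp only [subst, ih₁ hM.1 h, ih₂ hM.2 (up_congr h)]

theorem Scoped.subst_eq {M : Term C ar} (hM : M.Scoped 0) (σ : ℕ → Term C ar) : M.subst σ = M :=
  (hM.subst_congr (fun j hj => absurd hj (by omega))).trans (subst_var M)

theorem Scoped.rename_eq {M : Term C ar} (hM : M.Scoped 0) (ξ : ℕ → ℕ) : M.rename ξ = M := by
  rw [rename_eq_subst, hM.subst_eq]

/-- Beyond its first `k` variables `inst` yields shifted variables, which `σ` would move. Scopedness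
of `A` keeps these from occurring. This is what the declaration rule needs, its types living outside
the ambient context. -/
theorem Scoped.subst_inst_subst {A : Term C ar} {n k : ℕ} (hA : A.Scoped k)
    (M : Fin n → Term C ar) (hk : k ≤ n) (σ : ℕ → Term C ar) :
    (A.subst (inst M k hk)).subst σ = A.subst (inst (fun i => (M i).subst σ) k hk) := by
  rw [subst_subst]
  refine hA.subst_congr fun j hj => ?_
  simp [inst, hj]

theorem Scoped.subst_inst_rename {A : Term C ar} {n k : ℕ} (hA : A.Scoped k)
    (M : Fin n → Term C ar) (hk : k ≤ n) (ξ : ℕ → ℕ) :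
    (A.subst (inst M k hk)).rename ξ = A.subst (inst (fun i => (M i).rename ξ) k hk) := by
  simp only [rename_eq_subst _ ξ, hA.subst_inst_subst]

end Term

open Term

/-! ### Conversion -/

section Conv

variable {R : Set (Rule C ar)}

theorem Step.subst {M N : Term C ar} (h : Step R M N) (σ : ℕ → Term C ar) :
    Step R (M.subst σ) (N.subst σ) := by
  induction h generalizing σ with
  | beta A M N => rw [subst_single_subst]; exact .beta _ _ _
  | rule r hr τ => rw [subst_subst, subst_subst]; exact .rule r hr _
  | const c args i M' _ ih =>
    have := Step.const c (fun j => (args j).subst σ) i _ (ih σ)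
    simp only [Term.subst]
    convert this using 2
    funext j
    by_cases hj : j = i
    · subst hj; simp
    · simp [hj]
  | appL N _ ih => exact .appL _ (ih σ)
  | appR M _ ih => exact .appR _ (ih σ)
  | lamL M _ ih => exact .lamL _ (ih σ)
  | lamR A _ ih => exact .lamR _ (ih _)
  | piL B _ ih => exact .piL _ (ih σ)
  | piR A _ ih => exact .piR _ (ih _)

theorem Conv.refl (M : Term C ar) : Conv R M M := Relation.EqvGen.refl M

theorem Conv.symm {M N : Term C ar} (h : Conv R M N) : Conv R N M := Relation.EqvGen.symm _ _ h

theorem Conv.trans {M N L : Term C ar} (h : Conv R M N) (h' : Conv R N L) : Conv R M L :=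
  Relation.EqvGen.trans _ _ _ h h'

theorem Step.conv {M N : Term C ar} (h : Step R M N) : Conv R M N := Relation.EqvGen.rel _ _ h

theorem Conv.map {f : Term C ar → Term C ar} (hf : ∀ M N, Step R M N → Step R (f M) (f N))
    {M N : Term C ar} (h : Conv R M N) : Conv R (f M) (f N) := by
  induction h with
  | rel _ _ h => exact (hf _ _ h).conv
  | refl _ => exact .refl _
  | symm _ _ _ ih => exact ih.symm
  | trans _ _ _ _ _ ih₁ ih₂ => exact ih₁.trans ih₂

theorem Conv.subst {M N : Term C ar} (h : Conv R M N) (σ : ℕ → Term C ar) :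
    Conv R (M.subst σ) (N.subst σ) :=
  h.map (f := Term.subst σ) fun _ _ h => h.subst σ

theorem Conv.rename {M N : Term C ar} (h : Conv R M N) (ξ : ℕ → ℕ) :
    Conv R (M.rename ξ) (N.rename ξ) := by
  simp only [rename_eq_subst]; exact h.subst _

theorem Conv.lam {M M' N N' : Term C ar} (h : Conv R M M') (h' : Conv R N N') :
    Conv R (.lam M N) (.lam M' N') :=
  (h.map (f := (Term.lam · N)) fun _ _ h => h.lamL _).trans
    (h'.map (f := (Term.lam M' ·)) fun _ _ h => h.lamR _)

theorem Conv.const_update (c : C) (args : Fin (ar c) → Term C ar) (i : Fin (ar c))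
    {M M' : Term C ar} (h : Conv R M M') :
    Conv R (.const c (Function.update args i M)) (.const c (Function.update args i M')) := by
  refine h.map (f := fun M => Term.const c (Function.update args i M)) fun M N h => ?_
  have := Step.const c (Function.update args i M) i N (by simpa using h)
  simpa using this

theorem Conv.const (c : C) {args args' : Fin (ar c) → Term C ar}
    (h : ∀ i, Conv R (args i) (args' i)) : Conv R (.const c args) (.const c args') := by
  -- The arguments are replaced one at a time; `s` is the set of positions already replaced.
  have key : ∀ s : Finset (Fin (ar c)), Conv R (.const c args) (.const c (s.piecewise args' args)) := by
    intro s
    induction s using Finset.induction_on with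
    | empty => simpa using Conv.refl _
    | insert i s hi ih =>
      rw [Finset.piecewise_insert]
      refine ih.trans ?_
      have := Conv.const_update c (s.piecewise args' args) i (h i)
      rwa [Function.update_eq_self_iff.2 (by simp [hi])] at this
  simpa using key Finset.univ

end Conv

/-! ### Typing -/

section Typing

variable {T : Theory C ar}

/-- Every rule either assumes well-formedness of its context or has a premise over the same context,
so the motive on contexts can be trivial. -/
theorem Typed.wf {Γ : List (Term C ar)} {M A : Term C ar} (h : Typed T Γ M A) : WF T Γ := by
  refine Typed.rec (T := T) (motive_1 := fun _ _ => True) (motive_2 := fun Γ _ _ _ => WF T Γ)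
    ?_ ?_ ?_ ?_ ?_ ?_ ?_ ?_ ?_ h <;> intros <;> trivial

/-- Induction on typing derivations, ignoring the well-formedness derivations of contexts. -/
@[elab_as_elim]
theorem Typed.induction {motive : ∀ Γ M A, Typed T Γ M A → Prop}
    (cons : ∀ {Γ : List (Term C ar)} {s : Term C ar} (d : Decl C ar) (hd : d ∈ T.sig)
      (M : Fin (ar d.head) → Term C ar) (hs : s.IsSort) (hΓ : WF T Γ)
      (hA : Typed T d.ctxList d.type s)
      (hM : ∀ i : Fin (ar d.head), Typed T Γ (M i) ((d.ctx i).subst (Term.inst M i i.isLt.le))),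
      motive _ _ _ hA → (∀ i : Fin (ar d.head), motive _ _ _ (hM i)) →
      motive _ _ _ (.cons d hd M hs hΓ hA hM))
    (sort : ∀ {Γ : List (Term C ar)} (hΓ : WF T Γ), motive _ _ _ (.sort hΓ))
    (var : ∀ {Γ : List (Term C ar)} {A : Term C ar} (n : ℕ) (hΓ : WF T Γ) (hn : Γ[n]? = some A),
      motive _ _ _ (.var n hΓ hn))
    (conv : ∀ {Γ : List (Term C ar)} {M A B s : Term C ar} (hs : s.IsSort)
      (hM : Typed T Γ M A) (hB : Typed T Γ B s) (hc : Conv T.rules A B),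
      motive _ _ _ hM → motive _ _ _ hB → motive _ _ _ (.conv hs hM hB hc))
    (prod : ∀ {Γ : List (Term C ar)} {A B s : Term C ar} (hs : s.IsSort)
      (hA : Typed T Γ A .type) (hB : Typed T (A :: Γ) B s),
      motive _ _ _ hA → motive _ _ _ hB → motive _ _ _ (.prod hs hA hB))
    (app : ∀ {Γ : List (Term C ar)} {M N A B : Term C ar}
      (hM : Typed T Γ M (.pi A B)) (hN : Typed T Γ N A),
      motive _ _ _ hM → motive _ _ _ hN → motive _ _ _ (.app hM hN))
    (abs : ∀ {Γ : List (Term C ar)} {A B M s : Term C ar} (hs : s.IsSort)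
      (hA : Typed T Γ A .type) (hB : Typed T (A :: Γ) B s) (hM : Typed T (A :: Γ) M B),
      motive _ _ _ hA → motive _ _ _ hB → motive _ _ _ hM → motive _ _ _ (.abs hs hA hB hM))
    {Γ : List (Term C ar)} {M A : Term C ar} (h : Typed T Γ M A) : motive Γ M A h := by
  refine Typed.rec (T := T) (motive_1 := fun _ _ => True) (motive_2 := motive)
    ?_ ?_ ?_ ?_ ?_ ?_ ?_ ?_ ?_ h
  · trivial
  · intros; trivial
  · intro Γ s d hd M hs hΓ hA hM _ ih₁ ih₂; exact cons d hd M hs hΓ hA hM ih₁ ih₂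
  · intro Γ h _; exact sort h
  · intro Γ A n h hn _; exact var n h hn
  · intro Γ M A B s hs h₁ h₂ h₃ ih₁ ih₂; exact conv hs h₁ h₂ h₃ ih₁ ih₂
  · intro Γ A B s hs h₁ h₂ ih₁ ih₂; exact prod hs h₁ h₂ ih₁ ih₂
  · intro Γ M N A B h₁ h₂ ih₁ ih₂; exact app h₁ h₂ ih₁ ih₂
  · intro Γ A B M s hs h₁ h₂ h₃ ih₁ ih₂ ih₃; exact abs hs h₁ h₂ h₃ ih₁ ih₂ ih₃

theorem Typed.scoped {Γ : List (Term C ar)} {M A : Term C ar} (h : Typed T Γ M A) :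
    M.Scoped Γ.length := by
  induction h using Typed.induction with
  | cons d hd M hs _ _ _ _ ih => exact ih
  | sort _ => trivial
  | var n _ hn => exact (List.getElem?_eq_some_iff.1 hn).1
  | conv _ _ _ _ ih _ => exact ih
  | prod _ _ _ ih₁ ih₂ => exact ⟨ih₁, ih₂⟩
  | app _ _ ih₁ ih₂ => exact ⟨ih₁, ih₂⟩
  | abs _ _ _ _ ih₁ _ ih₃ => exact ⟨ih₁, ih₃⟩

theorem WF.scoped {Γ : List (Term C ar)} (h : WF T Γ) (n : ℕ) {A : Term C ar}
    (hn : Γ[n]? = some A) : A.Scoped (Γ.length - (n + 1)) := by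
  induction Γ generalizing n with
  | nil => simp at hn
  | cons B Γ ih =>
    cases h with
    | decl hB =>
      cases n with
      | zero => simp only [List.getElem?_cons_zero, Option.some.injEq] at hn
                subst hn; simpa using hB.scoped
      | succ n => simpa using ih hB.wf n (by simpa using hn)

theorem Decl.length_ctxList (d : Decl C ar) : d.ctxList.length = ar d.head := by
  simp [Decl.ctxList]

theorem Decl.scoped_ctx (d : Decl C ar) (h : WF T d.ctxList) (i : Fin (ar d.head)) :
    (d.ctx i).Scoped i := by
  -- The list is reversed, so entry `i` of the declaration sits at index `ar d.head - 1 - i` and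
  -- sees exactly `i` earlier variables.
  have := h.scoped (ar d.head - 1 - i) (A := d.ctx i) (by
    rw [Decl.ctxList, List.getElem?_reverse (by simp; omega)]
    simp only [List.length_ofFn]
    rw [show ar d.head - 1 - (ar d.head - 1 - (i : ℕ)) = i by omega]
    simp)
  rw [d.length_ctxList] at this
  convert this using 1
  omega

/-- `ξ` is a renaming of the variables of `Γ` into those of `Δ`. -/
def IsRen (Γ Δ : List (Term C ar)) (ξ : ℕ → ℕ) : Prop :=
  ∀ n A, Γ[n]? = some A → ∃ A', Δ[ξ n]? = some A' ∧
    (A.rename (fun k => k + (n + 1))).rename ξ = A'.rename (fun k => k + (ξ n + 1))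

theorem IsRen.up {Γ Δ : List (Term C ar)} {ξ : ℕ → ℕ} (h : IsRen Γ Δ ξ) (B : Term C ar) :
    IsRen (B :: Γ) (B.rename ξ :: Δ) (upRen ξ) := by
  rintro (_ | n) A hn
  · simp only [List.getElem?_cons_zero, Option.some.injEq] at hn
    subst hn
    exact ⟨_, rfl, by simp only [rename_rename]; rfl⟩
  · obtain ⟨A', h₁, h₂⟩ := h n A (by simpa using hn)
    refine ⟨A', by simpa [upRen] using h₁, ?_⟩
    simp only [upRen]
    rw [rename_add_succ, rename_add_succ, ← h₂]
    simp only [rename_rename]; rfl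

theorem isRen_succ (Γ : List (Term C ar)) (B : Term C ar) : IsRen Γ (B :: Γ) Nat.succ :=
  fun n A hn => ⟨A, by simpa using hn, (rename_add_succ A n).symm⟩

theorem Typed.rename {Γ : List (Term C ar)} {M A : Term C ar} (h : Typed T Γ M A)
    {Δ : List (Term C ar)} {ξ : ℕ → ℕ} (hξ : IsRen Γ Δ ξ) (hΔ : WF T Δ) :
    Typed T Δ (M.rename ξ) (A.rename ξ) := by
  induction h using Typed.induction generalizing Δ ξ with
  | cons d hd M hs _ hA _ _ ih =>
    -- The derivation for the declared type is kept unchanged: it supplies scopedness of that type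
    -- and, through its context, of the parameter types.
    rw [Scoped.subst_inst_rename (d.length_ctxList ▸ hA.scoped)]
    refine .cons d hd _ hs hΔ hA fun i => ?_
    rw [← (d.scoped_ctx hA.wf i).subst_inst_rename]
    exact ih i hξ hΔ
  | sort _ => exact .sort hΔ
  | var n _ hn =>
    obtain ⟨A', h₁, h₂⟩ := hξ n _ hn
    rw [h₂]; exact .var _ hΔ h₁
  | conv hs _ _ hc ih₁ ih₂ =>
    -- A sort is invariant under renaming, but only by computation once it is known to be `TYPE` or
    -- `KIND`; hence the later splits on `hs`.
    refine .conv (s := _) ?_ (ih₁ hξ hΔ) (ih₂ hξ hΔ) (hc.rename ξ)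
    rcases hs with rfl | rfl
    exacts [.inl rfl, .inr rfl]
  | prod hs _ _ ih₁ ih₂ =>
    have hA := ih₁ hξ hΔ
    have hB := ih₂ (hξ.up _) (.decl hA)
    rcases hs with rfl | rfl
    exacts [.prod (.inl rfl) hA hB, .prod (.inr rfl) hA hB]
  | app _ _ ih₁ ih₂ =>
    rw [subst_single_rename]; exact .app (ih₁ hξ hΔ) (ih₂ hξ hΔ)
  | abs hs _ _ _ ih₁ ih₂ ih₃ =>
    have hA := ih₁ hξ hΔ
    have hB := ih₂ (hξ.up _) (.decl hA)
    have hM := ih₃ (hξ.up _) (.decl hA)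
    rcases hs with rfl | rfl
    exacts [.abs (.inl rfl) hA hB hM, .abs (.inr rfl) hA hB hM]

theorem Typed.weaken {Γ : List (Term C ar)} {M A B : Term C ar} (h : Typed T Γ M A)
    (hB : WF T (B :: Γ)) : Typed T (B :: Γ) (M.rename Nat.succ) (A.rename Nat.succ) :=
  h.rename (isRen_succ Γ B) hB

theorem Typed.of_nil {M A : Term C ar} (h : Typed T [] M A)
    {Γ : List (Term C ar)} (hΓ : WF T Γ) : Typed T Γ M A := by
  have := h.rename (Δ := Γ) (ξ := id) (fun n A hn => by simp at hn) hΓ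
  rwa [rename_id, rename_id] at this

/-- `σ` is a substitution of terms over `Δ` for the variables of `Γ`. -/
def IsSubst (T : Theory C ar) (Γ Δ : List (Term C ar)) (σ : ℕ → Term C ar) : Prop :=
  ∀ n A, Γ[n]? = some A → Typed T Δ (σ n) ((A.rename (fun k => k + (n + 1))).subst σ)

theorem IsSubst.up {Γ Δ : List (Term C ar)} {σ : ℕ → Term C ar} (h : IsSubst T Γ Δ σ)
    {B : Term C ar} (hB : WF T (B.subst σ :: Δ)) :
    IsSubst T (B :: Γ) (B.subst σ :: Δ) (up σ) := by
  rintro (_ | n) A hn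
  · simp only [List.getElem?_cons_zero, Option.some.injEq] at hn
    subst hn
    have := Typed.var (T := T) (Γ := B.subst σ :: Δ) 0 hB rfl
    simp only [rename_subst, subst_rename] at this ⊢
    exact this
  · have := (h n A (by simpa using hn)).weaken hB
    rw [rename_add_succ, rename_succ_subst_up]; exact this

theorem isSubst_single {Γ : List (Term C ar)} {N A : Term C ar} (hN : Typed T Γ N A) :
    IsSubst T (A :: Γ) Γ (single N) := by
  rintro (_ | n) B hn
  · simp only [List.getElem?_cons_zero, Option.some.injEq] at hn
    subst hn
    rw [show (fun k => k + (0 + 1)) = Nat.succ from rfl, rename_succ_subst_single]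
    exact hN
  · rw [rename_add_succ, rename_succ_subst_single]
    exact .var n hN.wf (by simpa using hn)

theorem Typed.subst {Γ : List (Term C ar)} {M A : Term C ar} (h : Typed T Γ M A)
    {Δ : List (Term C ar)} {σ : ℕ → Term C ar} (hσ : IsSubst T Γ Δ σ) (hΔ : WF T Δ) :
    Typed T Δ (M.subst σ) (A.subst σ) := by
  induction h using Typed.induction generalizing Δ σ with
  | cons d hd M hs _ hA _ _ ih =>
    rw [Scoped.subst_inst_subst (d.length_ctxList ▸ hA.scoped)]
    refine .cons d hd _ hs hΔ hA fun i => ?_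
    rw [← (d.scoped_ctx hA.wf i).subst_inst_subst]
    exact ih i hσ hΔ
  | sort _ => exact .sort hΔ
  | var n _ hn => exact hσ n _ hn
  | conv hs _ _ hc ih₁ ih₂ =>
    refine .conv (s := _) ?_ (ih₁ hσ hΔ) (ih₂ hσ hΔ) (hc.subst σ)
    rcases hs with rfl | rfl
    exacts [.inl rfl, .inr rfl]
  | prod hs _ _ ih₁ ih₂ =>
    have hA := ih₁ hσ hΔ
    have hB := ih₂ (hσ.up (.decl hA)) (.decl hA)
    rcases hs with rfl | rfl
    exacts [.prod (.inl rfl) hA hB, .prod (.inr rfl) hA hB]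
  | app _ _ ih₁ ih₂ =>
    rw [subst_single_subst]; exact .app (ih₁ hσ hΔ) (ih₂ hσ hΔ)
  | abs hs _ _ _ ih₁ ih₂ ih₃ =>
    have hA := ih₁ hσ hΔ
    have hB := ih₂ (hσ.up (.decl hA)) (.decl hA)
    have hM := ih₃ (hσ.up (.decl hA)) (.decl hA)
    rcases hs with rfl | rfl
    exacts [.abs (.inl rfl) hA hB hM, .abs (.inr rfl) hA hB hM]

end Typing

end DK

-- Metatheory of functional EPTSs: substitution, confluence, subject reduction

namespace EPTS

open DK (upRen upRen_id upRen_comp)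

variable {S : Type u}

namespace Term

theorem rename_rename (M : Term S) (ξ ζ : ℕ → ℕ) :
    (M.rename ξ).rename ζ = M.rename (ζ ∘ ξ) := by
  induction M generalizing ξ ζ <;> simp_all [rename, upRen_comp]

theorem up_comp_upRen (σ : ℕ → Term S) (ξ : ℕ → ℕ) : up (σ ∘ ξ) = up σ ∘ upRen ξ := by
  funext n; cases n <;> rfl

theorem rename_subst (M : Term S) (ξ : ℕ → ℕ) (σ : ℕ → Term S) :
    (M.rename ξ).subst σ = M.subst (σ ∘ ξ) := by
  induction M generalizing ξ σ <;> simp_all [rename, subst, up_comp_upRen]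

theorem up_rename_comp (σ : ℕ → Term S) (ξ : ℕ → ℕ) :
    up (fun n => (σ n).rename ξ) = fun n => (up σ n).rename (upRen ξ) := by
  funext n
  cases n with
  | zero => rfl
  | succ n => simp only [up, rename_rename]; rfl

theorem subst_rename (M : Term S) (σ : ℕ → Term S) (ξ : ℕ → ℕ) :
    (M.subst σ).rename ξ = M.subst (fun n => (σ n).rename ξ) := by
  induction M generalizing ξ σ <;> simp_all [rename, subst, up_rename_comp]

theorem up_subst_comp (σ τ : ℕ → Term S) :
    up (fun n => (σ n).subst τ) = fun n => (up σ n).subst (up τ) := by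
  funext n
  cases n with
  | zero => rfl
  | succ n => simp only [up, subst_rename, rename_subst]; rfl

theorem subst_subst (M : Term S) (σ τ : ℕ → Term S) :
    (M.subst σ).subst τ = M.subst (fun n => (σ n).subst τ) := by
  induction M generalizing σ τ <;> simp_all [subst, up_subst_comp]

theorem up_var : up (var : ℕ → Term S) = var := by
  funext n; cases n <;> rfl

theorem subst_var (M : Term S) : M.subst var = M := by
  induction M <;> simp_all [subst, up_var]

theorem rename_eq_subst (M : Term S) (ξ : ℕ → ℕ) : M.rename ξ = M.subst (fun n => var (ξ n)) := by
  conv_lhs => rw [← subst_var M, subst_rename]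
  rfl

theorem subst_single_subst (M N : Term S) (σ : ℕ → Term S) :
    (M.subst (single N)).subst σ = (M.subst (up σ)).subst (single (N.subst σ)) := by
  simp only [subst_subst]
  congr 1
  funext n
  cases n with
  | zero => rfl
  | succ n => simp only [single, up, subst, rename_subst]; exact (subst_var _).symm

theorem subst_single_rename (M N : Term S) (ξ : ℕ → ℕ) :
    (M.subst (single N)).rename ξ = (M.rename (upRen ξ)).subst (single (N.rename ξ)) := by
  simp only [subst_rename, rename_subst]
  congr 1
  funext n
  cases n <;> rfl

theorem rename_succ_subst_up (M : Term S) (σ : ℕ → Term S) :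
    (M.rename Nat.succ).subst (up σ) = (M.subst σ).rename Nat.succ := by
  rw [rename_subst, subst_rename]; rfl

theorem rename_succ_subst_single (M N : Term S) :
    (M.rename Nat.succ).subst (single N) = M := by
  rw [rename_subst]; exact subst_var M

theorem rename_add_succ (M : Term S) (n : ℕ) :
    M.rename (fun k => k + (n + 1 + 1)) = (M.rename (fun k => k + (n + 1))).rename Nat.succ := by
  rw [rename_rename]; rfl

end Term

open Term

variable {P : Spec S}

/-! ### Reduction and conversion -/

theorem Step.subst {M N : Term S} (h : Step P M N) (σ : ℕ → Term S) :
    Step P (M.subst σ) (N.subst σ) := by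
  induction h generalizing σ with
  | beta A B A' B' M N h => rw [subst_single_subst]; exact .beta _ _ _ _ _ _ h
  | pi₁ s₁ s₂ B _ ih => exact .pi₁ _ _ _ (ih _)
  | pi₂ s₁ s₂ A _ ih => exact .pi₂ _ _ _ (ih _)
  | lam₁ s₁ s₂ B M _ ih => exact .lam₁ _ _ _ _ (ih _)
  | lam₂ s₁ s₂ A M _ ih => exact .lam₂ _ _ _ _ (ih _)
  | lam₃ s₁ s₂ A B _ ih => exact .lam₃ _ _ _ _ (ih _)
  | app₁ s₁ s₂ B M N _ ih => exact .app₁ _ _ _ _ _ (ih _)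
  | app₂ s₁ s₂ A M N _ ih => exact .app₂ _ _ _ _ _ (ih _)
  | app₃ s₁ s₂ A B N _ ih => exact .app₃ _ _ _ _ _ (ih _)
  | app₄ s₁ s₂ A B M _ ih => exact .app₄ _ _ _ _ _ (ih _)

theorem Conv.refl (M : Term S) : Conv P M M := Relation.EqvGen.refl M

theorem Conv.symm {M N : Term S} (h : Conv P M N) : Conv P N M := Relation.EqvGen.symm _ _ h

theorem Conv.trans {M N L : Term S} (h : Conv P M N) (h' : Conv P N L) : Conv P M L :=
  Relation.EqvGen.trans _ _ _ h h'

theorem Step.conv {M N : Term S} (h : Step P M N) : Conv P M N := Relation.EqvGen.rel _ _ h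

theorem Conv.map {f : Term S → Term S} (hf : ∀ M N, Step P M N → Step P (f M) (f N))
    {M N : Term S} (h : Conv P M N) : Conv P (f M) (f N) := by
  induction h with
  | rel _ _ h => exact (hf _ _ h).conv
  | refl _ => exact .refl _
  | symm _ _ _ ih => exact ih.symm
  | trans _ _ _ _ _ ih₁ ih₂ => exact ih₁.trans ih₂

theorem Conv.subst {M N : Term S} (h : Conv P M N) (σ : ℕ → Term S) :
    Conv P (M.subst σ) (N.subst σ) :=
  h.map (f := Term.subst σ) fun _ _ h => h.subst σ

theorem Conv.rename {M N : Term S} (h : Conv P M N) (ξ : ℕ → ℕ) :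
    Conv P (M.rename ξ) (N.rename ξ) := by
  simp only [rename_eq_subst]; exact h.subst _

/-- Many-step reduction. -/
abbrev Red (P : Spec S) : Term S → Term S → Prop := Relation.ReflTransGen (Step P)

theorem Red.conv {M N : Term S} (h : Red P M N) : Conv P M N := by
  induction h with
  | refl => exact .refl _
  | tail _ h ih => exact ih.trans h.conv

theorem Red.pi {s₁ s₂ : S} {A A' B B' : Term S} (hA : Red P A A') (hB : Red P B B') :
    Red P (.pi s₁ s₂ A B) (.pi s₁ s₂ A' B') :=
  (hA.lift (Term.pi s₁ s₂ · B) fun _ _ h => .pi₁ _ _ _ h).trans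
    (hB.lift (Term.pi s₁ s₂ A' ·) fun _ _ h => .pi₂ _ _ _ h)

theorem Red.lam {s₁ s₂ : S} {A A' B B' M M' : Term S} (hA : Red P A A') (hB : Red P B B')
    (hM : Red P M M') : Red P (.lam s₁ s₂ A B M) (.lam s₁ s₂ A' B' M') :=
  ((hA.lift (Term.lam s₁ s₂ · B M) fun _ _ h => .lam₁ _ _ _ _ h).trans
    (hB.lift (Term.lam s₁ s₂ A' · M) fun _ _ h => .lam₂ _ _ _ _ h)).trans
    (hM.lift (Term.lam s₁ s₂ A' B' ·) fun _ _ h => .lam₃ _ _ _ _ h)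

theorem Red.app {s₁ s₂ : S} {A A' B B' M M' N N' : Term S} (hA : Red P A A') (hB : Red P B B')
    (hM : Red P M M') (hN : Red P N N') :
    Red P (.app s₁ s₂ A B M N) (.app s₁ s₂ A' B' M' N') :=
  (((hA.lift (Term.app s₁ s₂ · B M N) fun _ _ h => .app₁ _ _ _ _ _ h).trans
    (hB.lift (Term.app s₁ s₂ A' · M N) fun _ _ h => .app₂ _ _ _ _ _ h)).trans
    (hM.lift (Term.app s₁ s₂ A' B' · N) fun _ _ h => .app₃ _ _ _ _ _ h)).trans
    (hN.lift (Term.app s₁ s₂ A' B' M' ·) fun _ _ h => .app₄ _ _ _ _ _ h)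

/-! ### Confluence -/

/-- Parallel reduction. -/
inductive Par (P : Spec S) : Term S → Term S → Prop
  | var (n : ℕ) : Par P (.var n) (.var n)
  | sort (s : S) : Par P (.sort s) (.sort s)
  | pi {s₁ s₂ : S} {A A' B B' : Term S} : Par P A A' → Par P B B' →
      Par P (.pi s₁ s₂ A B) (.pi s₁ s₂ A' B')
  | lam {s₁ s₂ : S} {A A' B B' M M' : Term S} : Par P A A' → Par P B B' → Par P M M' →
      Par P (.lam s₁ s₂ A B M) (.lam s₁ s₂ A' B' M')
  | app {s₁ s₂ : S} {A A' B B' M M' N N' : Term S} : Par P A A' → Par P B B' → Par P M M' →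
      Par P N N' → Par P (.app s₁ s₂ A B M N) (.app s₁ s₂ A' B' M' N')
  | beta {s₁ s₂ s₃ : S} {A B A' B' M M' N N' : Term S} : P.rel s₁ s₂ s₃ → Par P M M' →
      Par P N N' →
      Par P (.app s₁ s₂ A B (.lam s₁ s₂ A' B' M) N) (M'.subst (Term.single N'))

theorem Par.refl (M : Term S) : Par P M M := by
  induction M with
  | var n => exact .var n
  | sort s => exact .sort s
  | pi _ _ _ _ ih₁ ih₂ => exact .pi ih₁ ih₂
  | lam _ _ _ _ _ ih₁ ih₂ ih₃ => exact .lam ih₁ ih₂ ih₃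
  | app _ _ _ _ _ _ ih₁ ih₂ ih₃ ih₄ => exact .app ih₁ ih₂ ih₃ ih₄

theorem Step.par {M N : Term S} (h : Step P M N) : Par P M N := by
  induction h with
  | beta A B A' B' M N h => exact .beta h (.refl _) (.refl _)
  | pi₁ s₁ s₂ B _ ih => exact .pi ih (.refl _)
  | pi₂ s₁ s₂ A _ ih => exact .pi (.refl _) ih
  | lam₁ s₁ s₂ B M _ ih => exact .lam ih (.refl _) (.refl _)
  | lam₂ s₁ s₂ A M _ ih => exact .lam (.refl _) ih (.refl _)
  | lam₃ s₁ s₂ A B _ ih => exact .lam (.refl _) (.refl _) ih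
  | app₁ s₁ s₂ B M N _ ih => exact .app ih (.refl _) (.refl _) (.refl _)
  | app₂ s₁ s₂ A M N _ ih => exact .app (.refl _) ih (.refl _) (.refl _)
  | app₃ s₁ s₂ A B N _ ih => exact .app (.refl _) (.refl _) ih (.refl _)
  | app₄ s₁ s₂ A B M _ ih => exact .app (.refl _) (.refl _) (.refl _) ih

theorem Par.red {M N : Term S} (h : Par P M N) : Red P M N := by
  induction h with
  | var n => exact .refl
  | sort s => exact .refl
  | pi _ _ ih₁ ih₂ => exact ih₁.pi ih₂
  | lam _ _ _ ih₁ ih₂ ih₃ => exact ih₁.lam ih₂ ih₃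
  | app _ _ _ _ ih₁ ih₂ ih₃ ih₄ => exact ih₁.app ih₂ ih₃ ih₄
  | beta h _ _ ih₁ ih₂ =>
    exact (Red.app .refl .refl (Red.lam .refl .refl ih₁) ih₂).tail (.beta _ _ _ _ _ _ h)

theorem Par.rename {M N : Term S} (h : Par P M N) (ξ : ℕ → ℕ) :
    Par P (M.rename ξ) (N.rename ξ) := by
  induction h generalizing ξ with
  | var n => exact .refl _
  | sort s => exact .refl _
  | pi _ _ ih₁ ih₂ => exact .pi (ih₁ _) (ih₂ _)
  | lam _ _ _ ih₁ ih₂ ih₃ => exact .lam (ih₁ _) (ih₂ _) (ih₃ _)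
  | app _ _ _ _ ih₁ ih₂ ih₃ ih₄ => exact .app (ih₁ _) (ih₂ _) (ih₃ _) (ih₄ _)
  | beta h _ _ ih₁ ih₂ => rw [subst_single_rename]; exact .beta h (ih₁ _) (ih₂ _)

theorem Par.up {σ τ : ℕ → Term S} (h : ∀ n, Par P (σ n) (τ n)) (n : ℕ) :
    Par P (up σ n) (up τ n) := by
  cases n with
  | zero => exact .refl _
  | succ n => exact (h n).rename _

theorem Par.subst {M N : Term S} (h : Par P M N) {σ τ : ℕ → Term S}
    (hσ : ∀ n, Par P (σ n) (τ n)) : Par P (M.subst σ) (N.subst τ) := by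
  induction h generalizing σ τ with
  | var n => exact hσ n
  | sort s => exact .refl _
  | pi _ _ ih₁ ih₂ => exact .pi (ih₁ hσ) (ih₂ (Par.up hσ))
  | lam _ _ _ ih₁ ih₂ ih₃ => exact .lam (ih₁ hσ) (ih₂ (Par.up hσ)) (ih₃ (Par.up hσ))
  | app _ _ _ _ ih₁ ih₂ ih₃ ih₄ => exact .app (ih₁ hσ) (ih₂ (Par.up hσ)) (ih₃ hσ) (ih₄ hσ)
  | beta h _ _ ih₁ ih₂ =>
    rw [subst_single_subst]; exact .beta h (ih₁ (Par.up hσ)) (ih₂ hσ)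

theorem Par.subst_single {M M' N N' : Term S} (hM : Par P M M') (hN : Par P N N') :
    Par P (M.subst (single N)) (M'.subst (single N')) := by
  refine hM.subst fun n => ?_
  cases n with
  | zero => exact hN
  | succ n => exact .refl _

/-- The rule is linear: β ignores the type annotations of both the application and the abstraction.
The only overlap is thus β against a congruence step, and a parallel reduct of an abstraction is an
abstraction with the same sorts, so the redex survives. -/
theorem Par.diamond {M N₁ N₂ : Term S} (h₁ : Par P M N₁) (h₂ : Par P M N₂) :
    ∃ L, Par P N₁ L ∧ Par P N₂ L := by
  induction h₁ generalizing N₂ with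
  | var n => exact ⟨_, h₂, .refl _⟩
  | sort s => exact ⟨_, h₂, .refl _⟩
  | pi _ _ ih₁ ih₂ =>
    cases h₂ with
    | pi a b =>
      obtain ⟨A, a₁, a₂⟩ := ih₁ a
      obtain ⟨B, b₁, b₂⟩ := ih₂ b
      exact ⟨_, .pi a₁ b₁, .pi a₂ b₂⟩
  | lam _ _ _ ih₁ ih₂ ih₃ =>
    cases h₂ with
    | lam a b m =>
      obtain ⟨A, a₁, a₂⟩ := ih₁ a
      obtain ⟨B, b₁, b₂⟩ := ih₂ b
      obtain ⟨M, m₁, m₂⟩ := ih₃ m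
      exact ⟨_, .lam a₁ b₁ m₁, .lam a₂ b₂ m₂⟩
  | app _ _ h _ ih₁ ih₂ ih₃ ih₄ =>
    cases h₂ with
    | app a b m n =>
      obtain ⟨A, a₁, a₂⟩ := ih₁ a
      obtain ⟨B, b₁, b₂⟩ := ih₂ b
      obtain ⟨M, m₁, m₂⟩ := ih₃ m
      obtain ⟨N, n₁, n₂⟩ := ih₄ n
      exact ⟨_, .app a₁ b₁ m₁ n₁, .app a₂ b₂ m₂ n₂⟩
    | beta hr m n =>
      obtain ⟨N, n₁, n₂⟩ := ih₄ n
      -- The induction hypothesis concerns the whole abstraction, so the step on its body is wrapped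
      -- in one with unchanged annotations; inverting `l₁` and `l₂` recovers a join of the bodies.
      obtain ⟨L, l₁, l₂⟩ := ih₃ (.lam (.refl _) (.refl _) m)
      cases h
      cases l₁ with
      | lam _ _ m₁ =>
        cases l₂ with
        | lam _ _ m₂ => exact ⟨_, .beta hr m₁ n₁, m₂.subst_single n₂⟩
  | beta hr _ _ ih₁ ih₂ =>
    cases h₂ with
    | app a b m n =>
      obtain ⟨N, n₁, n₂⟩ := ih₂ n
      cases m with
      | lam _ _ m =>
        obtain ⟨M, m₁, m₂⟩ := ih₁ m
        exact ⟨_, m₁.subst_single n₁, .beta hr m₂ n₂⟩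
    | beta _ m n =>
      obtain ⟨M, m₁, m₂⟩ := ih₁ m
      obtain ⟨N, n₁, n₂⟩ := ih₂ n
      exact ⟨_, m₁.subst_single n₁, m₂.subst_single n₂⟩

/-- Confluence of reduction. -/
theorem Conv.exists_red {M N : Term S} (h : Conv P M N) : ∃ L, Red P M L ∧ Red P N L := by
  have cr : ∀ {a b c : Term S}, Red P a b → Red P a c → ∃ d, Red P b d ∧ Red P c d := by
    have to_red : ∀ {a b : Term S}, Relation.ReflTransGen (Par P) a b → Red P a b := by
      intro a b h
      induction h with
      | refl => exact .refl
      | tail _ h ih => exact ih.trans h.red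
    intro a b c hb hc
    obtain ⟨d, h₁, h₂⟩ := Relation.church_rosser (r := Par P)
      (fun a b c h₁ h₂ => let ⟨d, h₁, h₂⟩ := h₁.diamond h₂; ⟨d, .single h₁, .single h₂⟩)
      (Relation.ReflTransGen.mono (fun _ _ => Step.par) _ _ hb)
      (Relation.ReflTransGen.mono (fun _ _ => Step.par) _ _ hc)
    exact ⟨d, to_red h₁, to_red h₂⟩
  induction h with
  | rel _ _ h => exact ⟨_, .single h, .refl⟩
  | refl _ => exact ⟨_, .refl, .refl⟩
  | symm _ _ _ ih => obtain ⟨L, h₁, h₂⟩ := ih; exact ⟨L, h₂, h₁⟩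
  | trans _ _ _ _ _ ih₁ ih₂ =>
    obtain ⟨L₁, h₁, h₂⟩ := ih₁
    obtain ⟨L₂, h₃, h₄⟩ := ih₂
    obtain ⟨L, h₅, h₆⟩ := cr h₂ h₃
    exact ⟨L, h₁.trans h₅, h₄.trans h₆⟩

theorem Red.sort_inv {s : S} {M : Term S} (h : Red P (.sort s) M) : M = .sort s := by
  induction h with
  | refl => rfl
  | tail _ h ih => subst ih; cases h

theorem Red.pi_inv {s₁ s₂ : S} {A B M : Term S} (h : Red P (.pi s₁ s₂ A B) M) :
    ∃ A' B', M = .pi s₁ s₂ A' B' ∧ Red P A A' ∧ Red P B B' := by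
  induction h with
  | refl => exact ⟨_, _, rfl, .refl, .refl⟩
  | tail _ h ih =>
    obtain ⟨A', B', rfl, hA, hB⟩ := ih
    cases h with
    | pi₁ _ _ _ h => exact ⟨_, _, rfl, hA.tail h, hB⟩
    | pi₂ _ _ _ h => exact ⟨_, _, rfl, hA, hB.tail h⟩

theorem Conv.sort_inj {s s' : S} (h : Conv P (.sort s) (.sort s')) : s = s' := by
  obtain ⟨L, h₁, h₂⟩ := h.exists_red
  have := h₁.sort_inv.symm.trans h₂.sort_inv
  injection this

/-- A product is never a redex, so its reducts are products reduced componentwise; a common reduct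
compares the components. -/
theorem Conv.pi_inj {s₁ s₂ s₁' s₂' : S} {A B A' B' : Term S}
    (h : Conv P (.pi s₁ s₂ A B) (.pi s₁' s₂' A' B')) : Conv P A A' ∧ Conv P B B' := by
  obtain ⟨L, h₁, h₂⟩ := h.exists_red
  obtain ⟨C, D, rfl, hC, hD⟩ := h₁.pi_inv
  obtain ⟨C', D', h, hC', hD'⟩ := h₂.pi_inv
  injection h with _ _ h h'
  subst h h'
  exact ⟨hC.conv.trans hC'.conv.symm, hD.conv.trans hD'.conv.symm⟩

/-- The variable may occur any number of times in `M`; one parallel step reduces all the copies of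
`N`. -/
theorem Conv.subst_single_right (M : Term S) {N N' : Term S} (h : Step P N N') :
    Conv P (M.subst (single N)) (M.subst (single N')) :=
  ((Par.refl M).subst_single h.par).red.conv

/-! ### Typing -/

theorem Typed.wf {Γ : List (Term S)} {M A : Term S} (h : Typed P Γ M A) : WF P Γ := by
  refine Typed.rec (P := P) (motive_1 := fun _ _ => True) (motive_2 := fun Γ _ _ _ => WF P Γ)
    ?_ ?_ ?_ ?_ ?_ ?_ ?_ ?_ h <;> intros <;> trivial

/-- Induction on typing derivations, ignoring the well-formedness derivations of contexts. -/
@[elab_as_elim]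
theorem Typed.induction {motive : ∀ Γ M A, Typed P Γ M A → Prop}
    (conv : ∀ {Γ : List (Term S)} {M A B : Term S} {s : S} (hM : Typed P Γ M A)
      (hB : Typed P Γ B (.sort s)) (hc : Conv P A B),
      motive _ _ _ hM → motive _ _ _ hB → motive _ _ _ (.conv hM hB hc))
    (sort : ∀ {Γ : List (Term S)} {s₁ s₂ : S} (hΓ : WF P Γ) (h : P.ax s₁ s₂),
      motive _ _ _ (.sort hΓ h))
    (var : ∀ {Γ : List (Term S)} {A : Term S} (n : ℕ) (hΓ : WF P Γ) (hn : Γ[n]? = some A),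
      motive _ _ _ (.var n hΓ hn))
    (prod : ∀ {Γ : List (Term S)} {A B : Term S} {s₁ s₂ s₃ : S} (hr : P.rel s₁ s₂ s₃)
      (hA : Typed P Γ A (.sort s₁)) (hB : Typed P (A :: Γ) B (.sort s₂)),
      motive _ _ _ hA → motive _ _ _ hB → motive _ _ _ (.prod hr hA hB))
    (abs : ∀ {Γ : List (Term S)} {A B M : Term S} {s₁ s₂ s₃ : S} (hr : P.rel s₁ s₂ s₃)
      (hA : Typed P Γ A (.sort s₁)) (hB : Typed P (A :: Γ) B (.sort s₂))
      (hM : Typed P (A :: Γ) M B),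
      motive _ _ _ hA → motive _ _ _ hB → motive _ _ _ hM → motive _ _ _ (.abs hr hA hB hM))
    (app : ∀ {Γ : List (Term S)} {A B M N : Term S} {s₁ s₂ s₃ : S} (hr : P.rel s₁ s₂ s₃)
      (hA : Typed P Γ A (.sort s₁)) (hB : Typed P (A :: Γ) B (.sort s₂)) (hN : Typed P Γ N A)
      (hM : Typed P Γ M (.pi s₁ s₂ A B)),
      motive _ _ _ hA → motive _ _ _ hB → motive _ _ _ hN → motive _ _ _ hM →
      motive _ _ _ (.app hr hA hB hN hM))
    {Γ : List (Term S)} {M A : Term S} (h : Typed P Γ M A) : motive Γ M A h := by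
  refine Typed.rec (P := P) (motive_1 := fun _ _ => True) (motive_2 := motive)
    ?_ ?_ ?_ ?_ ?_ ?_ ?_ ?_ h
  · trivial
  · intros; trivial
  · intro Γ M A B s h₁ h₂ h₃ ih₁ ih₂; exact conv h₁ h₂ h₃ ih₁ ih₂
  · intro Γ s₁ s₂ hΓ h _; exact sort hΓ h
  · intro Γ A n h hn _; exact var n h hn
  · intro Γ A B s₁ s₂ s₃ hr h₁ h₂ ih₁ ih₂; exact prod hr h₁ h₂ ih₁ ih₂
  · intro Γ A B M s₁ s₂ s₃ hr h₁ h₂ h₃ ih₁ ih₂ ih₃; exact abs hr h₁ h₂ h₃ ih₁ ih₂ ih₃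
  · intro Γ A B M N s₁ s₂ s₃ hr h₁ h₂ h₃ h₄ ih₁ ih₂ ih₃ ih₄
    exact app hr h₁ h₂ h₃ h₄ ih₁ ih₂ ih₃ ih₄

/-- `ξ` is a renaming of the variables of `Γ` into those of `Δ`. -/
def IsRen (Γ Δ : List (Term S)) (ξ : ℕ → ℕ) : Prop :=
  ∀ n A, Γ[n]? = some A → ∃ A', Δ[ξ n]? = some A' ∧
    (A.rename (fun k => k + (n + 1))).rename ξ = A'.rename (fun k => k + (ξ n + 1))

theorem IsRen.up {Γ Δ : List (Term S)} {ξ : ℕ → ℕ} (h : IsRen Γ Δ ξ) (B : Term S) :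
    IsRen (B :: Γ) (B.rename ξ :: Δ) (upRen ξ) := by
  rintro (_ | n) A hn
  · simp only [List.getElem?_cons_zero, Option.some.injEq] at hn
    subst hn
    exact ⟨_, rfl, by simp only [rename_rename]; rfl⟩
  · obtain ⟨A', h₁, h₂⟩ := h n A (by simpa using hn)
    refine ⟨A', by simpa [upRen] using h₁, ?_⟩
    simp only [upRen]
    rw [rename_add_succ, rename_add_succ, ← h₂]
    simp only [rename_rename]; rfl

theorem isRen_succ (Γ : List (Term S)) (B : Term S) : IsRen Γ (B :: Γ) Nat.succ :=
  fun n A hn => ⟨A, by simpa using hn, (rename_add_succ A n).symm⟩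

theorem Typed.rename {Γ : List (Term S)} {M A : Term S} (h : Typed P Γ M A)
    {Δ : List (Term S)} {ξ : ℕ → ℕ} (hξ : IsRen Γ Δ ξ) (hΔ : WF P Δ) :
    Typed P Δ (M.rename ξ) (A.rename ξ) := by
  induction h using Typed.induction generalizing Δ ξ with
  | conv _ _ hc ih₁ ih₂ => exact .conv (ih₁ hξ hΔ) (ih₂ hξ hΔ) (hc.rename ξ)
  | sort _ h => exact .sort hΔ h
  | var n _ hn =>
    obtain ⟨A', h₁, h₂⟩ := hξ n _ hn
    rw [h₂]; exact .var _ hΔ h₁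
  | prod hr _ _ ih₁ ih₂ =>
    have hA := ih₁ hξ hΔ
    exact .prod hr hA (ih₂ (hξ.up _) (.decl hA))
  | abs hr _ _ _ ih₁ ih₂ ih₃ =>
    have hA := ih₁ hξ hΔ
    exact .abs hr hA (ih₂ (hξ.up _) (.decl hA)) (ih₃ (hξ.up _) (.decl hA))
  | app hr _ _ _ _ ih₁ ih₂ ih₃ ih₄ =>
    have hA := ih₁ hξ hΔ
    rw [subst_single_rename]
    exact .app hr hA (ih₂ (hξ.up _) (.decl hA)) (ih₃ hξ hΔ) (ih₄ hξ hΔ)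

theorem Typed.weaken {Γ : List (Term S)} {M A B : Term S} (h : Typed P Γ M A)
    (hB : WF P (B :: Γ)) : Typed P (B :: Γ) (M.rename Nat.succ) (A.rename Nat.succ) :=
  h.rename (isRen_succ Γ B) hB

/-- `σ` is a substitution of terms over `Δ` for the variables of `Γ`. -/
def IsSubst (P : Spec S) (Γ Δ : List (Term S)) (σ : ℕ → Term S) : Prop :=
  ∀ n A, Γ[n]? = some A → Typed P Δ (σ n) ((A.rename (fun k => k + (n + 1))).subst σ)

theorem IsSubst.up {Γ Δ : List (Term S)} {σ : ℕ → Term S} (h : IsSubst P Γ Δ σ)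
    {B : Term S} (hB : WF P (B.subst σ :: Δ)) :
    IsSubst P (B :: Γ) (B.subst σ :: Δ) (up σ) := by
  rintro (_ | n) A hn
  · simp only [List.getElem?_cons_zero, Option.some.injEq] at hn
    subst hn
    have := Typed.var (P := P) (Γ := B.subst σ :: Δ) 0 hB rfl
    simp only [rename_subst, subst_rename] at this ⊢
    exact this
  · have := (h n A (by simpa using hn)).weaken hB
    rw [rename_add_succ, rename_succ_subst_up]; exact this

theorem isSubst_single {Γ : List (Term S)} {N A : Term S} (hN : Typed P Γ N A) :
    IsSubst P (A :: Γ) Γ (single N) := by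
  rintro (_ | n) B hn
  · simp only [List.getElem?_cons_zero, Option.some.injEq] at hn
    subst hn
    rw [show (fun k => k + (0 + 1)) = Nat.succ from rfl, rename_succ_subst_single]
    exact hN
  · rw [rename_add_succ, rename_succ_subst_single]
    exact .var n hN.wf (by simpa using hn)

theorem Typed.subst {Γ : List (Term S)} {M A : Term S} (h : Typed P Γ M A)
    {Δ : List (Term S)} {σ : ℕ → Term S} (hσ : IsSubst P Γ Δ σ) (hΔ : WF P Δ) :
    Typed P Δ (M.subst σ) (A.subst σ) := by
  induction h using Typed.induction generalizing Δ σ with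
  | conv _ _ hc ih₁ ih₂ => exact .conv (ih₁ hσ hΔ) (ih₂ hσ hΔ) (hc.subst σ)
  | sort _ h => exact .sort hΔ h
  | var n _ hn => exact hσ n _ hn
  | prod hr _ _ ih₁ ih₂ =>
    have hA := ih₁ hσ hΔ
    exact .prod hr hA (ih₂ (hσ.up (.decl hA)) (.decl hA))
  | abs hr _ _ _ ih₁ ih₂ ih₃ =>
    have hA := ih₁ hσ hΔ
    exact .abs hr hA (ih₂ (hσ.up (.decl hA)) (.decl hA)) (ih₃ (hσ.up (.decl hA)) (.decl hA))
  | app hr _ _ _ _ ih₁ ih₂ ih₃ ih₄ =>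
    have hA := ih₁ hσ hΔ
    rw [subst_single_subst]
    exact .app hr hA (ih₂ (hσ.up (.decl hA)) (.decl hA)) (ih₃ hσ hΔ) (ih₄ hσ hΔ)

theorem Typed.subst_single {Γ : List (Term S)} {M A N B : Term S} (hM : Typed P (A :: Γ) M B)
    (hN : Typed P Γ N A) : Typed P Γ (M.subst (single N)) (B.subst (single N)) :=
  hM.subst (isSubst_single hN) hN.wf

/-- Replacing the most recent declaration by a convertible one. -/
theorem Typed.conv_head {Γ : List (Term S)} {A A' M B : Term S} {s s' : S}
    (h : Typed P (A :: Γ) M B) (hA : Typed P Γ A (.sort s)) (hA' : Typed P Γ A' (.sort s'))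
    (hc : Conv P A A') : Typed P (A' :: Γ) M B := by
  have hΔ : WF P (A' :: Γ) := .decl hA'
  -- The identity is a substitution between the two contexts; only variable `0` needs the conversion
  -- rule.
  have := h.subst (Δ := A' :: Γ) (σ := .var) (fun n C hn => by
    rw [subst_var]
    cases n with
    | zero =>
      simp only [List.getElem?_cons_zero, Option.some.injEq] at hn
      subst hn
      exact .conv (.var 0 hΔ rfl) (hA.weaken hΔ) (hc.symm.rename _)
    | succ n => exact .var (n + 1) hΔ (by simpa using hn)) hΔ
  rwa [subst_var, subst_var] at this

/-- `C` is `A`, or a well-sorted type convertible to `A`. -/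
def TyConv (P : Spec S) (Γ : List (Term S)) (A C : Term S) : Prop :=
  A = C ∨ Conv P A C ∧ ∃ s, Typed P Γ C (.sort s)

theorem TyConv.conv {Γ : List (Term S)} {A C : Term S} (h : TyConv P Γ A C) : Conv P A C := by
  rcases h with rfl | h
  exacts [.refl _, h.1]

theorem Typed.tyConv {Γ : List (Term S)} {M A C : Term S} (h : Typed P Γ M A)
    (hc : TyConv P Γ A C) : Typed P Γ M C := by
  rcases hc with rfl | ⟨hc, s, hs⟩
  exacts [h, .conv h hs hc]

/-- The premises of the typing rule for `M`, its type being `C` up to conversion. -/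
def Gen (P : Spec S) (Γ : List (Term S)) : Term S → Term S → Prop
  | var n, C => ∃ A, Γ[n]? = some A ∧ TyConv P Γ (A.rename (fun k => k + (n + 1))) C
  | sort s, C => ∃ s', P.ax s s' ∧ TyConv P Γ (sort s') C
  | pi s₁ s₂ A B, C => ∃ s₃, P.rel s₁ s₂ s₃ ∧ Typed P Γ A (sort s₁) ∧
      Typed P (A :: Γ) B (sort s₂) ∧ TyConv P Γ (sort s₃) C
  | lam s₁ s₂ A B M, C => ∃ s₃, P.rel s₁ s₂ s₃ ∧ Typed P Γ A (sort s₁) ∧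
      Typed P (A :: Γ) B (sort s₂) ∧ Typed P (A :: Γ) M B ∧ TyConv P Γ (pi s₁ s₂ A B) C
  | app s₁ s₂ A B M N, C => ∃ s₃, P.rel s₁ s₂ s₃ ∧ Typed P Γ A (sort s₁) ∧
      Typed P (A :: Γ) B (sort s₂) ∧ Typed P Γ N A ∧ Typed P Γ M (pi s₁ s₂ A B) ∧
      TyConv P Γ (B.subst (single N)) C

/-- Successive conversions merge into the last one, whose target has a sort. The equality
alternative of `TyConv` covers derivations without conversion, where the type may be a top-sort and
have no sort at all. -/
theorem Typed.gen {Γ : List (Term S)} {M C : Term S} (h : Typed P Γ M C) : Gen P Γ M C := by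
  induction h using Typed.induction with
  | @conv Γ M A B s hM hB hc ih _ =>
    have key : ∀ {D}, TyConv P Γ D A → TyConv P Γ D B := fun h => .inr ⟨h.conv.trans hc, s, hB⟩
    cases M with
    | var n => obtain ⟨A, h₁, h₂⟩ := ih; exact ⟨A, h₁, key h₂⟩
    | sort s => obtain ⟨A, h₁, h₂⟩ := ih; exact ⟨A, h₁, key h₂⟩
    | pi => obtain ⟨A, h₁, h₂, h₃, h₄⟩ := ih; exact ⟨A, h₁, h₂, h₃, key h₄⟩
    | lam => obtain ⟨A, h₁, h₂, h₃, h₄, h₅⟩ := ih; exact ⟨A, h₁, h₂, h₃, h₄, key h₅⟩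
    | app => obtain ⟨A, h₁, h₂, h₃, h₄, h₅, h₆⟩ := ih; exact ⟨A, h₁, h₂, h₃, h₄, h₅, key h₆⟩
  | sort _ h => exact ⟨_, h, .inl rfl⟩
  | var n _ hn => exact ⟨_, hn, .inl rfl⟩
  | prod hr hA hB => exact ⟨_, hr, hA, hB, .inl rfl⟩
  | abs hr hA hB hM => exact ⟨_, hr, hA, hB, hM, .inl rfl⟩
  | app hr hA hB hN hM => exact ⟨_, hr, hA, hB, hN, hM, .inl rfl⟩

/-- Uniqueness of types up to conversion. -/
theorem Typed.conv_unique {Γ : List (Term S)} {M C D : Term S} (h₁ : Typed P Γ M C)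
    (h₂ : Typed P Γ M D) : Conv P C D := by
  have h₁ := h₁.gen
  have h₂ := h₂.gen
  -- No induction is needed: annotations determine the types of abstractions and applications.
  -- Functionality of the axioms and of the rules enters only for sorts and products.
  cases M with
  | var n =>
    obtain ⟨A, a, b⟩ := h₁
    obtain ⟨A', a', b'⟩ := h₂
    obtain rfl : A = A' := by simpa [a] using a'
    exact b.conv.symm.trans b'.conv
  | sort s =>
    obtain ⟨A, a, b⟩ := h₁
    obtain ⟨A', a', b'⟩ := h₂
    obtain rfl := P.ax_functional _ _ _ a a'
    exact b.conv.symm.trans b'.conv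
  | pi =>
    obtain ⟨A, a, _, _, b⟩ := h₁
    obtain ⟨A', a', _, _, b'⟩ := h₂
    obtain rfl := P.rel_functional _ _ _ _ a a'
    exact b.conv.symm.trans b'.conv
  | lam => exact h₁.choose_spec.2.2.2.2.conv.symm.trans h₂.choose_spec.2.2.2.2.conv
  | app => exact h₁.choose_spec.2.2.2.2.2.conv.symm.trans h₂.choose_spec.2.2.2.2.2.conv

theorem Typed.sort_unique {Γ : List (Term S)} {A : Term S} {s s' : S}
    (h₁ : Typed P Γ A (.sort s)) (h₂ : Typed P Γ A (.sort s')) : s = s' :=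
  (h₁.conv_unique h₂).sort_inj

theorem Typed.ax_of_sort {Γ : List (Term S)} {s s' : S} (h : Typed P Γ (.sort s) (.sort s')) :
    P.ax s s' := by
  obtain ⟨t, ht, hc⟩ := h.gen
  rwa [← hc.conv.sort_inj]

/-- Subject reduction. -/
theorem Step.typed {M M' : Term S} (h : Step P M M') {Γ : List (Term S)} {C : Term S}
    (hM : Typed P Γ M C) : Typed P Γ M' C := by
  induction h generalizing Γ C with
  | beta A B A' B' M N _ =>
    obtain ⟨s₃, hr, hA, hB, hN, hM, hc⟩ := hM.gen
    obtain ⟨s₃', hr', hA', hB', hM', hc'⟩ := hM.gen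
    -- The abstraction carries its own annotations. The argument is converted to its domain `A'`,
    -- and the type of the result back from `B'` to `B`.
    obtain ⟨c₁, c₂⟩ := hc'.conv.pi_inj
    refine Typed.tyConv ?_ hc
    exact .conv (hM'.subst_single (.conv hN hA' c₁.symm)) (hB.subst_single hN) (c₂.subst _)
  | pi₁ s₁ s₂ B h ih =>
    obtain ⟨s₃, hr, hA, hB, hc⟩ := hM.gen
    exact (Typed.prod hr (ih hA) (hB.conv_head hA (ih hA) h.conv)).tyConv hc
  | pi₂ s₁ s₂ A h ih =>
    obtain ⟨s₃, hr, hA, hB, hc⟩ := hM.gen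
    exact (Typed.prod hr hA (ih hB)).tyConv hc
  | lam₁ s₁ s₂ B M h ih =>
    obtain ⟨s₃, hr, hA, hB, hM, hc⟩ := hM.gen
    -- Reducing an annotation changes the product assigned to the abstraction; it is converted back
    -- to the original product, which is still well-sorted.
    refine Typed.tyConv (.conv (.abs hr (ih hA) (hB.conv_head hA (ih hA) h.conv)
      (hM.conv_head hA (ih hA) h.conv)) (.prod hr hA hB) (Step.pi₁ _ _ _ h).conv.symm) hc
  | lam₂ s₁ s₂ A M h ih =>
    obtain ⟨s₃, hr, hA, hB, hM, hc⟩ := hM.gen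
    refine Typed.tyConv (.conv (.abs hr hA (ih hB) (.conv hM (ih hB) h.conv))
      (.prod hr hA hB) (Step.pi₂ _ _ _ h).conv.symm) hc
  | lam₃ s₁ s₂ A B h ih =>
    obtain ⟨s₃, hr, hA, hB, hM, hc⟩ := hM.gen
    exact (Typed.abs hr hA hB (ih hM)).tyConv hc
  | app₁ s₁ s₂ B M N h ih =>
    obtain ⟨s₃, hr, hA, hB, hN, hM, hc⟩ := hM.gen
    have hB' := hB.conv_head hA (ih hA) h.conv
    exact (Typed.app hr (ih hA) hB' (.conv hN (ih hA) h.conv)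
      (.conv hM (.prod hr (ih hA) hB') (Step.pi₁ _ _ _ h).conv)).tyConv hc
  | app₂ s₁ s₂ A M N h ih =>
    obtain ⟨s₃, hr, hA, hB, hN, hM, hc⟩ := hM.gen
    exact Typed.tyConv (.conv (.app hr hA (ih hB) hN
      (.conv hM (.prod hr hA (ih hB)) (Step.pi₂ _ _ _ h).conv))
      (hB.subst_single hN) (h.conv.symm.subst _)) hc
  | app₃ s₁ s₂ A B N h ih =>
    obtain ⟨s₃, hr, hA, hB, hN, hM, hc⟩ := hM.gen
    exact (Typed.app hr hA hB hN (ih hM)).tyConv hc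
  | app₄ s₁ s₂ A B M h ih =>
    obtain ⟨s₃, hr, hA, hB, hN, hM, hc⟩ := hM.gen
    exact Typed.tyConv (.conv (.app hr hA hB (ih hN) hM) (hB.subst_single hN)
      (Conv.subst_single_right _ h).symm) hc

theorem Red.typed {M M' : Term S} (h : Red P M M') {Γ : List (Term S)} {C : Term S}
    (hM : Typed P Γ M C) : Typed P Γ M' C := by
  induction h with
  | refl => exact hM
  | tail _ h ih => exact h.typed ih

/-- A conversion may pass through ill-typed terms, so sorts cannot be followed along it. By subject
reduction the common reduct inherits both sorts, and it has only one. -/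
theorem Conv.sort_unique {A B : Term S} (h : Conv P A B) {Γ : List (Term S)} {s s' : S}
    (hA : Typed P Γ A (.sort s)) (hB : Typed P Γ B (.sort s')) : s = s' := by
  obtain ⟨L, h₁, h₂⟩ := h.exists_red
  exact (h₁.typed hA).sort_unique (h₂.typed hB)

theorem WF.typed_lookup {Γ : List (Term S)} (h : WF P Γ) (n : ℕ) {A : Term S}
    (hn : Γ[n]? = some A) : ∃ s, Typed P Γ (A.rename (fun k => k + (n + 1))) (.sort s) := by
  induction Γ generalizing n with
  | nil => simp at hn
  | cons B Γ ih =>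
    obtain _ | hB := id h
    cases n with
    | zero =>
      simp only [List.getElem?_cons_zero, Option.some.injEq] at hn
      subst hn
      exact ⟨_, hB.weaken h⟩
    | succ n =>
      obtain ⟨s, hs⟩ := ih hB.wf n (by simpa using hn)
      exact ⟨s, by rw [rename_add_succ]; exact hs.weaken h⟩

/-- Correctness of types. -/
theorem Typed.type_correct {Γ : List (Term S)} {M A : Term S} (h : Typed P Γ M A) :
    (∃ s, A = .sort s) ∨ ∃ s, Typed P Γ A (.sort s) := by
  cases h with
  | conv _ h _ => exact .inr ⟨_, h⟩
  | sort _ _ => exact .inl ⟨_, rfl⟩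
  | var n hΓ hn => exact .inr (hΓ.typed_lookup n hn)
  | prod _ _ _ => exact .inl ⟨_, rfl⟩
  | abs hr hA hB _ => exact .inr ⟨_, .prod hr hA hB⟩
  | app _ _ hB hN _ => exact .inr ⟨_, hB.subst_single hN⟩

end EPTS

-- The encoding constants: substitution, conversion and typing

namespace SEnc

open DK DK.Term

variable {K : Type v} {arK : K → ℕ}

section Constants

variable (ξ : ℕ → ℕ) (σ : ℕ → Tm arK) (s s₁ s₂ A B M N : Tm arK)

-- Mapping over an explicit argument vector agrees with the vector of images only after checking
-- each index. These equations do so once per constant and let `simp` compute renamings and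
-- substitutions.
@[simp] theorem rename_tS : (tS : Tm arK).rename ξ = tS := by
  simp only [tS, rename]; congr 1; funext i; exact i.elim0

@[simp] theorem rename_tR : (tR s₁ s₂).rename ξ = tR (s₁.rename ξ) (s₂.rename ξ) := by
  simp only [tR, rename]; congr 1; funext i; revert i; simp [arity, Fin.forall_fin_succ]

@[simp] theorem rename_tU : (tU s).rename ξ = tU (s.rename ξ) := by
  simp only [tU, rename]; congr 1; funext i; revert i; simp [arity]

@[simp] theorem rename_tEl : (tEl s A).rename ξ = tEl (s.rename ξ) (A.rename ξ) := by
  simp only [tEl, rename]; congr 1; funext i; revert i; simp [arity, Fin.forall_fin_succ]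

@[simp] theorem rename_tCode : (tCode s).rename ξ = tCode (s.rename ξ) := by
  simp only [tCode, rename]; congr 1; funext i; revert i; simp [arity]

@[simp] theorem rename_tProd : (tProd s₁ s₂ A B).rename ξ =
    tProd (s₁.rename ξ) (s₂.rename ξ) (A.rename ξ) (B.rename ξ) := by
  simp only [tProd, rename]; congr 1; funext i; revert i; simp [arity, Fin.forall_fin_succ]

@[simp] theorem rename_tAbs : (tAbs s₁ s₂ A B M).rename ξ =
    tAbs (s₁.rename ξ) (s₂.rename ξ) (A.rename ξ) (B.rename ξ) (M.rename ξ) := by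
  simp only [tAbs, rename]; congr 1; funext i; revert i; simp [arity, Fin.forall_fin_succ]

@[simp] theorem rename_tApp : (tApp s₁ s₂ A B M N).rename ξ =
    tApp (s₁.rename ξ) (s₂.rename ξ) (A.rename ξ) (B.rename ξ) (M.rename ξ) (N.rename ξ) := by
  simp only [tApp, rename]; congr 1; funext i; revert i; simp [arity, Fin.forall_fin_succ]

@[simp] theorem subst_tS : (tS : Tm arK).subst σ = tS := by
  simp only [tS, subst]; congr 1; funext i; exact i.elim0

@[simp] theorem subst_tA : (tA s).subst σ = tA (s.subst σ) := by
  simp only [tA, subst]; congr 1; funext i; revert i; simp [arity]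

@[simp] theorem subst_tR : (tR s₁ s₂).subst σ = tR (s₁.subst σ) (s₂.subst σ) := by
  simp only [tR, subst]; congr 1; funext i; revert i; simp [arity, Fin.forall_fin_succ]

@[simp] theorem subst_tU : (tU s).subst σ = tU (s.subst σ) := by
  simp only [tU, subst]; congr 1; funext i; revert i; simp [arity]

@[simp] theorem subst_tEl : (tEl s A).subst σ = tEl (s.subst σ) (A.subst σ) := by
  simp only [tEl, subst]; congr 1; funext i; revert i; simp [arity, Fin.forall_fin_succ]

@[simp] theorem subst_tCode : (tCode s).subst σ = tCode (s.subst σ) := by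
  simp only [tCode, subst]; congr 1; funext i; revert i; simp [arity]

@[simp] theorem subst_tProd : (tProd s₁ s₂ A B).subst σ =
    tProd (s₁.subst σ) (s₂.subst σ) (A.subst σ) (B.subst σ) := by
  simp only [tProd, subst]; congr 1; funext i; revert i; simp [arity, Fin.forall_fin_succ]

@[simp] theorem subst_tAbs : (tAbs s₁ s₂ A B M).subst σ =
    tAbs (s₁.subst σ) (s₂.subst σ) (A.subst σ) (B.subst σ) (M.subst σ) := by
  simp only [tAbs, subst]; congr 1; funext i; revert i; simp [arity, Fin.forall_fin_succ]

@[simp] theorem subst_tApp : (tApp s₁ s₂ A B M N).subst σ =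
    tApp (s₁.subst σ) (s₂.subst σ) (A.subst σ) (B.subst σ) (M.subst σ) (N.subst σ) := by
  simp only [tApp, subst]; congr 1; funext i; revert i; simp [arity, Fin.forall_fin_succ]

end Constants

/-! ### Conversion between encoded terms -/

section Conversion

variable {R : Set (Rule (Const K) (arity arK))} {s s' s₁ s₂ A A' B B' M M' N N' : Tm arK}

theorem conv_tU (h : Conv R s s') : Conv R (tU s) (tU s') := by
  refine Conv.const (ar := arity arK) Const.univ ?_
  simpa [arity, Fin.forall_fin_succ] using h

theorem conv_tEl (hs : Conv R s s') (hA : Conv R A A') : Conv R (tEl s A) (tEl s' A') := by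
  refine Conv.const (ar := arity arK) Const.el ?_
  simpa [arity, Fin.forall_fin_succ] using ⟨hs, hA⟩

theorem conv_tProd (hA : Conv R A A') (hB : Conv R B B') :
    Conv R (tProd s₁ s₂ A B) (tProd s₁ s₂ A' B') := by
  refine Conv.const (ar := arity arK) Const.prod ?_
  simpa [arity, Fin.forall_fin_succ] using ⟨Conv.refl _, Conv.refl _, hA, hB⟩

theorem conv_tAbs (hA : Conv R A A') (hB : Conv R B B') (hM : Conv R M M') :
    Conv R (tAbs s₁ s₂ A B M) (tAbs s₁ s₂ A' B' M') := by
  refine Conv.const (ar := arity arK) Const.abs ?_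
  simpa [arity, Fin.forall_fin_succ] using ⟨Conv.refl _, Conv.refl _, hA, hB, hM⟩

theorem conv_tApp (hA : Conv R A A') (hB : Conv R B B') (hM : Conv R M M') (hN : Conv R N N') :
    Conv R (tApp s₁ s₂ A B M N) (tApp s₁ s₂ A' B' M' N') := by
  refine Conv.const (ar := arity arK) Const.app ?_
  simpa [arity, Fin.forall_fin_succ] using ⟨Conv.refl _, Conv.refl _, hA, hB, hM, hN⟩

theorem conv_tEl_tCode (hR : baseRules arK ⊆ R) (s s' : Tm arK) :
    Conv R (tEl s' (tCode s)) (tU s) := by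
  have := (Step.rule (R := R) ⟨.el, ![var 0, tCode (var 1)], tU (var 1)⟩
    (hR (by simp [baseRules])) (fun n => if n = 0 then s' else s)).conv
  change Conv R ((tEl (var 0) (tCode (var 1))).subst _) _ at this
  simpa [subst] using this

theorem conv_tApp_tAbs (hR : baseRules arK ⊆ R) (s₁ s₂ A B s₁' s₂' A' B' M N : Tm arK) :
    Conv R (tApp s₁ s₂ A B (tAbs s₁' s₂' A' B' M) N) (.app M N) := by
  have := (Step.rule (R := R) ⟨.app, ![var 0, var 1, var 2, var 3,
      tAbs (var 4) (var 5) (var 6) (var 7) (var 8), var 9], .app (var 8) (var 9)⟩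
    (hR (by simp [baseRules]))
    -- The default `tS` is irrelevant: the rule mentions only the variables `0` to `9`.
    (fun n => [s₁, s₂, A, B, s₁', s₂', A', B', M, N].getD n tS)).conv
  change Conv R ((tApp (var 0) (var 1) (var 2) (var 3)
      (tAbs (var 4) (var 5) (var 6) (var 7) (var 8)) (var 9)).subst _) _ at this
  simpa [subst] using this

end Conversion

/-! ### Typing of the constants -/

section Typing

variable {T : Theory (Const K) (arity arK)} {Γ : List (Tm arK)}

/-- The shifted type is separated into an equation, so that the expected type can be prescribed and
`simp` can check the shift. -/
theorem typed_var {A B : Tm arK} (n : ℕ) (hΓ : DK.WF T Γ) (hn : Γ[n]? = some A)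
    (hB : A.rename (fun k => k + (n + 1)) = B) : DK.Typed T Γ (var n) B :=
  hB ▸ .var n hΓ hn

theorem typed_tS (hT : baseSig arK ⊆ T.sig) (hΓ : DK.WF T Γ) : DK.Typed T Γ tS .type :=
  DK.Typed.cons (T := T) (s := .kind) ⟨.sortType, ![], .type⟩ (hT (by simp [baseSig])) ![]
    (.inr rfl) hΓ (.sort .empty) (fun i => i.elim0)

theorem wf_tS (hT : baseSig arK ⊆ T.sig) (hΓ : DK.WF T Γ) : DK.WF T (tS :: Γ) :=
  .decl (typed_tS hT hΓ)

theorem typed_tA (hT : baseSig arK ⊆ T.sig) {s : Tm arK} (hs : DK.Typed T Γ s tS) :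
    DK.Typed T Γ (tA s) tS := by
  have : DK.Typed T Γ (tA s) _ :=
    DK.Typed.cons (T := T) (s := .type) ⟨.axFun, ![tS], tS⟩ (hT (by simp [baseSig])) ![s]
    (.inl rfl) hs.wf (typed_tS hT (wf_tS hT .empty))
    (by simpa [arity, Fin.forall_fin_succ] using hs)
  simpa using this

theorem typed_tR (hT : baseSig arK ⊆ T.sig) {s₁ s₂ : Tm arK} (h₁ : DK.Typed T Γ s₁ tS)
    (h₂ : DK.Typed T Γ s₂ tS) : DK.Typed T Γ (tR s₁ s₂) tS := by
  have : DK.Typed T Γ (tR s₁ s₂) _ :=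
    DK.Typed.cons (T := T) (s := .type) ⟨.relFun, ![tS, tS], tS⟩ (hT (by simp [baseSig]))
    ![s₁, s₂] (.inl rfl) h₁.wf (typed_tS hT (wf_tS hT (wf_tS hT .empty)))
    (by simpa [arity, Fin.forall_fin_succ] using ⟨h₁, h₂⟩)
  simpa using this

theorem typed_tU (hT : baseSig arK ⊆ T.sig) {s : Tm arK} (hs : DK.Typed T Γ s tS) :
    DK.Typed T Γ (tU s) .type :=
  DK.Typed.cons (T := T) (s := .kind) ⟨.univ, ![tS], .type⟩ (hT (by simp [baseSig])) ![s]
    (.inr rfl) hs.wf (.sort (wf_tS hT .empty))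
    (by simpa [arity, Fin.forall_fin_succ] using hs)

theorem typed_tEl (hT : baseSig arK ⊆ T.sig) {s A : Tm arK} (hs : DK.Typed T Γ s tS)
    (hA : DK.Typed T Γ A (tU s)) : DK.Typed T Γ (tEl s A) .type := by
  have h₁ := wf_tS hT .empty
  refine DK.Typed.cons (T := T) (s := .kind) ⟨.el, ![tS, tU (var 0)], .type⟩
    (hT (by simp [baseSig])) ![s, A] (.inr rfl) hs.wf
    (.sort (.decl (typed_tU hT (typed_var (A := tS) 0 h₁ rfl (by simp)))))
    (by simpa [arity, Fin.forall_fin_succ, subst, inst] using ⟨hs, hA⟩)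

theorem typed_tCode (hT : baseSig arK ⊆ T.sig) {s : Tm arK} (hs : DK.Typed T Γ s tS) :
    DK.Typed T Γ (tCode s) (tU (tA s)) := by
  have h₁ := wf_tS hT .empty
  have : DK.Typed T Γ (tCode s) _ :=
    DK.Typed.cons (T := T) (s := .type) ⟨.code, ![tS], tU (tA (var 0))⟩
    (hT (by simp [baseSig])) ![s] (.inl rfl) hs.wf
    (typed_tU hT (typed_tA hT (typed_var (A := tS) 0 h₁ rfl (by simp))))
    (by simpa [arity, Fin.forall_fin_succ] using hs)
  simpa [subst, inst, arity] using this

/-- The declaration rule requires the declared type to be well-typed over its own parameters. The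
telescope `s₁, s₂, A, B` is shared by `Prod`, `abs` and `app`. -/
theorem wf_prod_ctx (hT : baseSig arK ⊆ T.sig) :
    DK.WF T [.pi (tEl (var 2) (var 0)) (tU (var 2)), tU (var 1), tS, tS] := by
  have h₂ := wf_tS hT (wf_tS hT .empty)
  have h₃ : DK.WF T [tU (var 1), tS, tS] :=
    .decl (typed_tU hT (typed_var 1 h₂ rfl (by simp)))
  have h : DK.Typed T [tU (var 1), tS, tS] (tEl (var 2) (var 0)) .type :=
    typed_tEl hT (typed_var 2 h₃ rfl (by simp)) (typed_var 0 h₃ rfl (by simp [rename]))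
  exact .decl (.prod (.inl rfl) h (typed_tU hT (typed_var 2 (.decl h) rfl (by simp))))

/-- The codomain of the type of `B` lies under a binder, hence the shift of `s₂`; it disappears for
the closed representations of sorts. -/
theorem typed_tProd (hT : baseSig arK ⊆ T.sig) {s₁ s₂ A B : Tm arK} (h₁ : DK.Typed T Γ s₁ tS)
    (h₂ : DK.Typed T Γ s₂ tS) (hA : DK.Typed T Γ A (tU s₁))
    (hB : DK.Typed T Γ B (.pi (tEl s₁ A) (tU (s₂.rename Nat.succ)))) :
    DK.Typed T Γ (tProd s₁ s₂ A B) (tU (tR s₁ s₂)) := by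
  have h₄ := wf_prod_ctx hT
  have : DK.Typed T Γ (tProd s₁ s₂ A B) _ :=
    DK.Typed.cons (T := T) (s := .type)
    ⟨.prod, ![tS, tS, tU (var 1), .pi (tEl (var 2) (var 0)) (tU (var 2))],
      tU (tR (var 3) (var 2))⟩
    (hT (by simp [baseSig])) ![s₁, s₂, A, B] (.inl rfl) h₁.wf
    (typed_tU hT (typed_tR hT (typed_var (A := tS) 3 h₄ rfl (by simp)) (typed_var (A := tS) 2 h₄ rfl (by simp))))
    (by simpa [arity, Fin.forall_fin_succ, subst, inst, up] using ⟨h₁, h₂, hA, hB⟩)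
  simpa [subst, inst, arity] using this

theorem typed_tProd_ctx (hT : baseSig arK ⊆ T.sig) :
    DK.Typed T [.pi (tEl (var 2) (var 0)) (tU (var 2)), tU (var 1), tS, tS]
      (tProd (var 3) (var 2) (var 1) (var 0)) (tU (tR (var 3) (var 2))) := by
  have h₄ := wf_prod_ctx hT
  exact typed_tProd hT (typed_var 3 h₄ rfl (by simp)) (typed_var 2 h₄ rfl (by simp))
    (typed_var 1 h₄ rfl (by simp [rename])) (typed_var 0 h₄ rfl (by simp [rename, upRen]))

theorem typed_tAbs (hT : baseSig arK ⊆ T.sig) {s₁ s₂ A B M : Tm arK}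
    (h₁ : DK.Typed T Γ s₁ tS) (h₂ : DK.Typed T Γ s₂ tS) (hA : DK.Typed T Γ A (tU s₁))
    (hB : DK.Typed T Γ B (.pi (tEl s₁ A) (tU (s₂.rename Nat.succ))))
    (hM : DK.Typed T Γ M (.pi (tEl s₁ A)
      (tEl (s₂.rename Nat.succ) (.app (B.rename Nat.succ) (var 0))))) :
    DK.Typed T Γ (tAbs s₁ s₂ A B M) (tEl (tR s₁ s₂) (tProd s₁ s₂ A B)) := by
  have h₄ := wf_prod_ctx hT
  have hEl : DK.Typed T [.pi (tEl (var 2) (var 0)) (tU (var 2)), tU (var 1), tS, tS]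
      (tEl (var 3) (var 1)) .type :=
    typed_tEl hT (typed_var 3 h₄ rfl (by simp)) (typed_var 1 h₄ rfl (by simp [rename]))
  have h₅ := DK.WF.decl hEl
  have happ : DK.Typed T (tEl (var 3) (var 1) ::
      [.pi (tEl (var 2) (var 0)) (tU (var 2)), tU (var 1), tS, tS])
      (.app (var 1) (var 0)) (tU (var 3)) := by
    have := DK.Typed.app (A := tEl (var 4) (var 2)) (B := tU (var 4))
      (typed_var 1 h₅ rfl (by simp [rename, upRen])) (typed_var 0 h₅ rfl (by simp [rename]))
    simpa [subst, single] using this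
  have h₆ : DK.WF T (.pi (tEl (var 3) (var 1)) (tEl (var 3) (.app (var 1) (var 0))) ::
      [.pi (tEl (var 2) (var 0)) (tU (var 2)), tU (var 1), tS, tS]) :=
    .decl (.prod (.inl rfl) hEl (typed_tEl hT (typed_var 3 h₅ rfl (by simp)) happ))
  -- The result type of `abs` is stated past the extra parameter `N`, so all indices move by one.
  have hty := (typed_tProd_ctx hT).weaken h₆
  simp only [rename_tProd, rename_tU, rename_tR, rename] at hty
  have : DK.Typed T Γ (tAbs s₁ s₂ A B M) _ :=
    DK.Typed.cons (T := T) (s := .type)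
    ⟨.abs, ![tS, tS, tU (var 1), .pi (tEl (var 2) (var 0)) (tU (var 2)),
        .pi (tEl (var 3) (var 1)) (tEl (var 3) (.app (var 1) (var 0)))],
      tEl (tR (var 4) (var 3)) (tProd (var 4) (var 3) (var 2) (var 1))⟩
    (hT (by simp [baseSig])) ![s₁, s₂, A, B, M] (.inl rfl) h₁.wf
    (typed_tEl hT (typed_tR hT (typed_var (A := tS) 4 h₆ rfl (by simp)) (typed_var (A := tS) 3 h₆ rfl (by simp))) hty)
    (by simpa [arity, Fin.forall_fin_succ, subst, inst, up] using ⟨h₁, h₂, hA, hB, hM⟩)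
  simpa [subst, inst, arity] using this

theorem typed_tApp (hT : baseSig arK ⊆ T.sig) {s₁ s₂ A B M N : Tm arK}
    (h₁ : DK.Typed T Γ s₁ tS) (h₂ : DK.Typed T Γ s₂ tS) (hA : DK.Typed T Γ A (tU s₁))
    (hB : DK.Typed T Γ B (.pi (tEl s₁ A) (tU (s₂.rename Nat.succ))))
    (hM : DK.Typed T Γ M (tEl (tR s₁ s₂) (tProd s₁ s₂ A B)))
    (hN : DK.Typed T Γ N (tEl s₁ A)) :
    DK.Typed T Γ (tApp s₁ s₂ A B M N) (tEl s₂ (.app B N)) := by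
  have h₄ := wf_prod_ctx hT
  have h₅ : DK.WF T (tEl (tR (var 3) (var 2)) (tProd (var 3) (var 2) (var 1) (var 0)) ::
      [.pi (tEl (var 2) (var 0)) (tU (var 2)), tU (var 1), tS, tS]) :=
    .decl (typed_tEl hT (typed_tR hT (typed_var 3 h₄ rfl (by simp))
      (typed_var 2 h₄ rfl (by simp))) (typed_tProd_ctx hT))
  have h₆ : DK.WF T (tEl (var 4) (var 2) ::
      tEl (tR (var 3) (var 2)) (tProd (var 3) (var 2) (var 1) (var 0)) ::
      [.pi (tEl (var 2) (var 0)) (tU (var 2)), tU (var 1), tS, tS]) :=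
    .decl (typed_tEl hT (typed_var 4 h₅ rfl (by simp)) (typed_var 2 h₅ rfl (by simp [rename])))
  have happ : DK.Typed T (tEl (var 4) (var 2) ::
      tEl (tR (var 3) (var 2)) (tProd (var 3) (var 2) (var 1) (var 0)) ::
      [.pi (tEl (var 2) (var 0)) (tU (var 2)), tU (var 1), tS, tS])
      (.app (var 2) (var 0)) (tU (var 4)) := by
    have := DK.Typed.app (A := tEl (var 5) (var 3)) (B := tU (var 5))
      (typed_var 2 h₆ rfl (by simp [rename, upRen])) (typed_var 0 h₆ rfl (by simp [rename]))
    simpa [subst, single] using this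
  have : DK.Typed T Γ (tApp s₁ s₂ A B M N) _ :=
    DK.Typed.cons (T := T) (s := .type)
    ⟨.app, ![tS, tS, tU (var 1), .pi (tEl (var 2) (var 0)) (tU (var 2)),
        tEl (tR (var 3) (var 2)) (tProd (var 3) (var 2) (var 1) (var 0)),
        tEl (var 4) (var 2)],
      tEl (var 4) (.app (var 2) (var 0))⟩
    (hT (by simp [baseSig])) ![s₁, s₂, A, B, M, N] (.inl rfl) h₁.wf
    (typed_tEl hT (typed_var (A := tS) 4 h₆ rfl (by simp)) happ)
    (by simpa [arity, Fin.forall_fin_succ, subst, inst, up] using ⟨h₁, h₂, hA, hB, hM, hN⟩)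
  simpa [subst, inst, arity] using this

end Typing

end SEnc

namespace SEnc

open DK.Term

variable {S : Type u} {K : Type v} {arK : K → ℕ}

/-! ### Translation, substitution and conversion -/

section Translation

variable {dot : S → Tm arK}

/-- Each `dot s` is closed, so the copies placed under binders by the translation are unaffected. -/
theorem tr_rename (hdot : ∀ s, (dot s).Scoped 0) (M : EPTS.Term S) (ξ : ℕ → ℕ) :
    tr dot (M.rename ξ) = (tr dot M).rename ξ := by
  have h : ∀ s (ξ : ℕ → ℕ), (dot s).rename ξ = dot s := fun s => (hdot s).rename_eq
  induction M generalizing ξ <;> simp_all [tr, EPTS.Term.rename, DK.Term.rename]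

theorem tr_up (hdot : ∀ s, (dot s).Scoped 0) (σ : ℕ → EPTS.Term S) :
    (fun n => tr dot (EPTS.Term.up σ n)) = DK.Term.up (fun n => tr dot (σ n)) := by
  funext n
  cases n with
  | zero => rfl
  | succ n => exact tr_rename hdot _ _

theorem tr_subst (hdot : ∀ s, (dot s).Scoped 0) (M : EPTS.Term S) (σ : ℕ → EPTS.Term S) :
    tr dot (M.subst σ) = (tr dot M).subst (fun n => tr dot (σ n)) := by
  have h : ∀ s (σ : ℕ → Tm arK), (dot s).subst σ = dot s := fun s => (hdot s).subst_eq
  induction M generalizing σ <;>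
    simp_all [tr, EPTS.Term.subst, DK.Term.subst, tr_up]

theorem tr_subst_single (hdot : ∀ s, (dot s).Scoped 0) (M N : EPTS.Term S) :
    tr dot (M.subst (EPTS.Term.single N)) = (tr dot M).subst (single (tr dot N)) := by
  rw [tr_subst hdot]
  congr 1
  funext n
  cases n <;> rfl

open DK (Conv) in
-- The target rule discards the annotations just as source β does. Congruence steps give conversions
-- rather than single steps, because `⟦A⟧` is also copied into the binders of the families.
theorem tr_step (hdot : ∀ s, (dot s).Scoped 0) {P : EPTS.Spec S}
    {R : Set (DK.Rule (Const K) (arity arK))} (hR : baseRules arK ⊆ R) {M N : EPTS.Term S}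
    (h : EPTS.Step P M N) : Conv R (tr dot M) (tr dot N) := by
  have el : ∀ {s A A'}, Conv R A A' → Conv R (tEl (dot s) A) (tEl (dot s) A') :=
    fun h => conv_tEl (.refl _) h
  induction h with
  | beta A B A' B' M N _ =>
    rw [tr_subst_single hdot]
    exact (conv_tApp_tAbs hR _ _ _ _ _ _ _ _ _ _).trans (DK.Step.beta _ _ _).conv
  | pi₁ s₁ s₂ B _ ih => exact conv_tProd ih (.lam (el ih) (.refl _))
  | pi₂ s₁ s₂ A _ ih => exact conv_tProd (.refl _) (.lam (.refl _) ih)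
  | lam₁ s₁ s₂ B M _ ih =>
    exact conv_tAbs ih (.lam (el ih) (.refl _)) (.lam (el ih) (.refl _))
  | lam₂ s₁ s₂ A M _ ih => exact conv_tAbs (.refl _) (.lam (.refl _) ih) (.refl _)
  | lam₃ s₁ s₂ A B _ ih => exact conv_tAbs (.refl _) (.refl _) (.lam (.refl _) ih)
  | app₁ s₁ s₂ B M N _ ih => exact conv_tApp ih (.lam (el ih) (.refl _)) (.refl _) (.refl _)
  | app₂ s₁ s₂ A M N _ ih => exact conv_tApp (.refl _) (.lam (.refl _) ih) (.refl _) (.refl _)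
  | app₃ s₁ s₂ A B N _ ih => exact conv_tApp (.refl _) (.refl _) ih (.refl _)
  | app₄ s₁ s₂ A B M _ ih => exact conv_tApp (.refl _) (.refl _) (.refl _) ih

theorem tr_conv (hdot : ∀ s, (dot s).Scoped 0) {P : EPTS.Spec S}
    {R : Set (DK.Rule (Const K) (arity arK))} (hR : baseRules arK ⊆ R) {M N : EPTS.Term S}
    (h : EPTS.Conv P M N) : DK.Conv R (tr dot M) (tr dot N) := by
  induction h with
  | rel _ _ h => exact tr_step hdot hR h
  | refl _ => exact .refl _
  | symm _ _ _ ih => exact ih.symm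
  | trans _ _ _ _ _ ih₁ ih₂ => exact ih₁.trans ih₂

/-- Uniqueness of sorts makes the choice in `trCtx` immaterial. -/
theorem trCtx_cons {P : EPTS.Spec S} {Γ : List (EPTS.Term S)} {A : EPTS.Term S} {s : S}
    (h : EPTS.Typed P Γ A (.sort s)) :
    trCtx P dot (A :: Γ) = tEl (dot s) (tr dot A) :: trCtx P dot Γ := by
  have h' : ∃ s, EPTS.Typed P Γ A (.sort s) := ⟨s, h⟩
  rw [trCtx, dif_pos h', h'.choose_spec.sort_unique h]

theorem trCtx_lookup (hdot : ∀ s, (dot s).Scoped 0) {P : EPTS.Spec S}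
    {Γ : List (EPTS.Term S)} (hΓ : EPTS.WF P Γ) (n : ℕ) {A : EPTS.Term S}
    (hn : Γ[n]? = some A) {s : S}
    (hs : EPTS.Typed P Γ (A.rename (fun k => k + (n + 1))) (.sort s)) :
    ∃ X, (trCtx P dot Γ)[n]? = some X ∧ X.rename (fun k => k + (n + 1)) =
      tEl (dot s) (tr dot (A.rename (fun k => k + (n + 1)))) := by
  induction Γ generalizing n s with
  | nil => simp at hn
  | cons B Γ ih =>
    obtain _ | hB := id hΓ
    rw [trCtx_cons hB]
    cases n with
    | zero =>
      simp only [List.getElem?_cons_zero, Option.some.injEq] at hn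
      subst hn
      obtain rfl := (hB.weaken hΓ).sort_unique hs
      exact ⟨_, rfl, by rw [rename_tEl, (hdot _).rename_eq, tr_rename hdot]⟩
    | succ n =>
      have hn : Γ[n]? = some A := by simpa using hn
      obtain ⟨t, ht⟩ := hB.wf.typed_lookup n hn
      rw [EPTS.Term.rename_add_succ] at hs ⊢
      -- The sort found in the shorter context is the one given in the full context, by weakening
      -- and uniqueness.
      obtain rfl := (ht.weaken hΓ).sort_unique hs
      obtain ⟨X, hX, hX'⟩ := ih hB.wf n hn ht
      refine ⟨X, by simpa using hX, ?_⟩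
      rw [rename_add_succ, hX', rename_tEl, (hdot _).rename_eq, tr_rename hdot (A.rename _) Nat.succ]

end Translation

/-! ### Soundness -/

namespace Represents

variable {P : EPTS.Spec S} {T : DK.Theory (Const K) (arity arK)} {dot : S → Tm arK}
  {Δ : List (Tm arK)}

theorem scoped_dot (hT : Represents P T dot) (s : S) : (dot s).Scoped 0 := (hT.typed s).scoped

theorem typed_dot (hT : Represents P T dot) (s : S) (hΔ : DK.WF T Δ) :
    DK.Typed T Δ (dot s) tS := (hT.typed s).of_nil hΔ

theorem typed_univ (hT : Represents P T dot) (s : S) (hΔ : DK.WF T Δ) :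
    DK.Typed T Δ (tU (dot s)) .type := typed_tU hT.sig_subset (hT.typed_dot s hΔ)

theorem typed_el (hT : Represents P T dot) {s : S} {X : Tm arK}
    (h : DK.Typed T Δ X (tU (dot s))) : DK.Typed T Δ (tEl (dot s) X) .type :=
  typed_tEl hT.sig_subset (hT.typed_dot s h.wf) h

theorem typed_code (hT : Represents P T dot) {s s' : S} (h : P.ax s s') (hΔ : DK.WF T Δ) :
    DK.Typed T Δ (tCode (dot s)) (tU (dot s')) :=
  .conv (.inl rfl) (typed_tCode hT.sig_subset (hT.typed_dot s hΔ)) (hT.typed_univ s' hΔ)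
    (conv_tU (hT.ax_conv s s' h))

theorem typed_el_code (hT : Represents P T dot) {s s' : S} (h : P.ax s s') {X : Tm arK}
    (hX : DK.Typed T Δ X (tU (dot s))) : DK.Typed T Δ X (tEl (dot s') (tCode (dot s))) :=
  .conv (.inl rfl) hX (hT.typed_el (hT.typed_code h hX.wf))
    (conv_tEl_tCode hT.rules_subset _ _).symm

/-- The rule for `El` on a code ignores its first argument, so `s'` may be any term. -/
theorem typed_univ_of_el_code (hT : Represents P T dot) {s : S} {s' X : Tm arK}
    (hX : DK.Typed T Δ X (tEl s' (tCode (dot s)))) : DK.Typed T Δ X (tU (dot s)) :=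
  .conv (.inl rfl) hX (hT.typed_univ s hX.wf) (conv_tEl_tCode hT.rules_subset _ _)

theorem typed_family (hT : Represents P T dot) {s₁ s₂ : S} {A B : Tm arK}
    (hA : DK.Typed T Δ A (tU (dot s₁)))
    (hB : DK.Typed T (tEl (dot s₁) A :: Δ) B (tU (dot s₂))) :
    DK.Typed T Δ (.lam (tEl (dot s₁) A) B)
      (.pi (tEl (dot s₁) A) (tU ((dot s₂).rename Nat.succ))) := by
  rw [(hT.scoped_dot s₂).rename_eq]
  exact .abs (.inl rfl) (hT.typed_el hA) (hT.typed_univ s₂ hB.wf) hB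

theorem typed_prod (hT : Represents P T dot) {s₁ s₂ : S} {A B : Tm arK}
    (hA : DK.Typed T Δ A (tU (dot s₁)))
    (hB : DK.Typed T (tEl (dot s₁) A :: Δ) B (tU (dot s₂))) :
    DK.Typed T Δ (tProd (dot s₁) (dot s₂) A (.lam (tEl (dot s₁) A) B))
      (tU (tR (dot s₁) (dot s₂))) :=
  typed_tProd hT.sig_subset (hT.typed_dot _ hA.wf) (hT.typed_dot _ hA.wf) hA
    (hT.typed_family hA hB)

theorem typed_prod_dot (hT : Represents P T dot) {s₁ s₂ s₃ : S} (hr : P.rel s₁ s₂ s₃)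
    {A B : Tm arK} (hA : DK.Typed T Δ A (tU (dot s₁)))
    (hB : DK.Typed T (tEl (dot s₁) A :: Δ) B (tU (dot s₂))) :
    DK.Typed T Δ (tProd (dot s₁) (dot s₂) A (.lam (tEl (dot s₁) A) B)) (tU (dot s₃)) :=
  .conv (.inl rfl) (hT.typed_prod hA hB) (hT.typed_univ s₃ hA.wf)
    (conv_tU (hT.rel_conv _ _ _ hr))

/-- Two conversions separate this from the declaration of `abs`: the body must have type `El ṡ₂ (B̄
x)`, which β-reduces to `El ṡ₂ B`, and `R̂ ṡ₁ ṡ₂` must be replaced by `ṡ₃`. -/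
theorem typed_abs (hT : Represents P T dot) {s₁ s₂ s₃ : S} (hr : P.rel s₁ s₂ s₃)
    {A B M : Tm arK} (hA : DK.Typed T Δ A (tU (dot s₁)))
    (hB : DK.Typed T (tEl (dot s₁) A :: Δ) B (tU (dot s₂)))
    (hM : DK.Typed T (tEl (dot s₁) A :: Δ) M (tEl (dot s₂) B)) :
    DK.Typed T Δ (tAbs (dot s₁) (dot s₂) A (.lam (tEl (dot s₁) A) B) (.lam (tEl (dot s₁) A) M))
      (tEl (dot s₃) (tProd (dot s₁) (dot s₂) A (.lam (tEl (dot s₁) A) B))) := by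
  have hΔ := hA.wf
  have happ := DK.Typed.app ((hT.typed_family hA hB).weaken hB.wf) (.var 0 hB.wf rfl)
  simp only [rename_tU, subst_tU, (hT.scoped_dot s₂).rename_eq, (hT.scoped_dot s₂).subst_eq] at happ
  have hbeta : DK.Conv T.rules (.app ((DK.Term.lam (tEl (dot s₁) A) B).rename Nat.succ) (var 0))
      B := by
    -- Weakening under the binder and then instantiating it by variable `0` is the identity
    -- substitution.
    have h : (B.rename (DK.upRen Nat.succ)).subst (single (var 0)) = B := by
      rw [rename_subst]
      refine Eq.trans ?_ (subst_var B)
      congr 1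
      funext n
      cases n <;> rfl
    have := (DK.Step.beta (R := T.rules) ((tEl (dot s₁) A).rename Nat.succ)
      (B.rename (DK.upRen Nat.succ)) (var 0)).conv
    rwa [h] at this
  have hEl := hT.typed_el happ
  have hlam := DK.Typed.abs (.inl rfl) (hT.typed_el hA) hEl
    (.conv (.inl rfl) hM hEl (conv_tEl (.refl _) hbeta.symm))
  have := typed_tAbs hT.sig_subset (hT.typed_dot s₁ hΔ) (hT.typed_dot s₂ hΔ) hA
    (hT.typed_family hA hB) (by rw [(hT.scoped_dot s₂).rename_eq]; exact hlam)
  exact .conv (.inl rfl) this (hT.typed_el (hT.typed_prod_dot hr hA hB))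
    (conv_tEl (hT.rel_conv _ _ _ hr) (.refl _))

/-- The type of `M` is taken back from `ṡ₃` to `R̂ ṡ₁ ṡ₂`, as the constant demands, and the
resulting `El ṡ₂ (B̄ N)` is β-reduced. -/
theorem typed_app (hT : Represents P T dot) {s₁ s₂ s₃ : S} (hr : P.rel s₁ s₂ s₃)
    {A B M N : Tm arK} (hA : DK.Typed T Δ A (tU (dot s₁)))
    (hB : DK.Typed T (tEl (dot s₁) A :: Δ) B (tU (dot s₂)))
    (hM : DK.Typed T Δ M
      (tEl (dot s₃) (tProd (dot s₁) (dot s₂) A (.lam (tEl (dot s₁) A) B))))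
    (hN : DK.Typed T Δ N (tEl (dot s₁) A)) :
    DK.Typed T Δ (tApp (dot s₁) (dot s₂) A (.lam (tEl (dot s₁) A) B) M N)
      (tEl (dot s₂) (B.subst (single N))) := by
  have h₁ := hT.typed_dot s₁ hA.wf
  have h₂ := hT.typed_dot s₂ hA.wf
  have hBN := hB.subst (DK.isSubst_single hN) hA.wf
  rw [subst_tU, (hT.scoped_dot s₂).subst_eq] at hBN
  refine .conv (.inl rfl) (typed_tApp hT.sig_subset h₁ h₂ hA (hT.typed_family hA hB) ?_ hN)
    (hT.typed_el hBN) (conv_tEl (.refl _) (DK.Step.beta _ _ _).conv)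
  exact .conv (.inl rfl) hM
    (typed_tEl hT.sig_subset (typed_tR hT.sig_subset h₁ h₂) (hT.typed_prod hA hB))
    (conv_tEl (hT.rel_conv _ _ _ hr).symm (.refl _))

end Represents

/-- The translation of `Γ ⊢ M : A` is derivable, with type `U ṡ` if `A` is a sort `s` and with type
`El ṡ ⟦A⟧` if `A` has a sort `s`. -/
def SoundJudgment (P : EPTS.Spec S) (T : DK.Theory (Const K) (arity arK)) (dot : S → Tm arK)
    (Γ : List (EPTS.Term S)) (M A : EPTS.Term S) : Prop :=
  (∀ s, A = .sort s → DK.Typed T (trCtx P dot Γ) (tr dot M) (tU (dot s))) ∧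
    ∀ s, EPTS.Typed P Γ A (.sort s) →
      DK.Typed T (trCtx P dot Γ) (tr dot M) (tEl (dot s) (tr dot A))

section Soundness

variable {P : EPTS.Spec S} {T : DK.Theory (Const K) (arity arK)} {dot : S → Tm arK}
  {Γ : List (EPTS.Term S)} {M A : EPTS.Term S} {s : S}

/-- For a sort that has a sort, either clause yields the other through `El s' (u s) ≡ U s`; with
`SoundJudgment.of_typed`, each typing rule has only one clause to check. -/
theorem SoundJudgment.of_sort (hT : Represents P T dot)
    (h : DK.Typed T (trCtx P dot Γ) (tr dot M) (tU (dot s))) :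
    SoundJudgment P T dot Γ M (.sort s) := by
  refine ⟨fun s' hs => ?_, fun s' hs => hT.typed_el_code hs.ax_of_sort h⟩
  injection hs with hs
  exact hs ▸ h

theorem SoundJudgment.of_typed (hT : Represents P T dot) (hA : EPTS.Typed P Γ A (.sort s))
    (h : DK.Typed T (trCtx P dot Γ) (tr dot M) (tEl (dot s) (tr dot A))) :
    SoundJudgment P T dot Γ M A := by
  refine ⟨fun s' hs => ?_, fun s' hs => hA.sort_unique hs ▸ h⟩
  subst hs
  exact hT.typed_univ_of_el_code h

theorem SoundJudgment.univ (h : SoundJudgment P T dot Γ M (.sort s)) :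
    DK.Typed T (trCtx P dot Γ) (tr dot M) (tU (dot s)) := h.1 s rfl

/-- The `U` clause covers all sorts, not just top-sorts, so that premises `Γ ⊢ A : s` can be used
uniformly. -/
theorem sound (hT : Represents P T dot) :
    (∀ {Γ : List (EPTS.Term S)}, EPTS.WF P Γ → DK.WF T (trCtx P dot Γ)) ∧
      ∀ {Γ : List (EPTS.Term S)} {M A : EPTS.Term S}, EPTS.Typed P Γ M A →
        SoundJudgment P T dot Γ M A := by
  have key : ∀ {Γ : List (EPTS.Term S)} {M A : EPTS.Term S}, EPTS.Typed P Γ M A →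
      SoundJudgment P T dot Γ M A := by
    intro Γ M A h
    -- The full mutual recursor is needed: the sort and variable rules use the translated
    -- well-formedness of their context.
    refine EPTS.Typed.rec (P := P) (motive_1 := fun Γ _ => DK.WF T (trCtx P dot Γ))
      (motive_2 := fun Γ M A _ => SoundJudgment P T dot Γ M A) ?_ ?_ ?_ ?_ ?_ ?_ ?_ ?_ h
    · exact .empty
    · intro Γ A s hA ih
      rw [trCtx_cons hA]
      exact .decl (hT.typed_el ih.univ)
    · intro Γ M A B s hM hB hc ihM ihB
      have hc' := tr_conv hT.scoped_dot hT.rules_subset hc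
      refine .of_typed hT hB ?_
      rcases hM.type_correct with ⟨t, rfl⟩ | ⟨t, ht⟩
      -- Here `A` is a sort `t`, possibly a top-sort without an `El` form: `U ṫ ≡ El ṡ (u ṫ) ≡ El ṡ
      -- ⟦B⟧`. Conversion being untyped, the middle term need not be well-typed.
      · exact .conv (.inl rfl) ihM.univ (hT.typed_el ihB.univ)
          ((conv_tEl_tCode hT.rules_subset _ _).symm.trans (conv_tEl (.refl _) hc'))
      · obtain rfl := hc.sort_unique ht hB
        exact .conv (.inl rfl) (ihM.2 _ ht) (hT.typed_el ihB.univ) (conv_tEl (.refl _) hc')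
    · intro Γ s₁ s₂ _ hs hΓ
      exact .of_sort hT (hT.typed_code hs hΓ)
    · intro Γ A n hΓ hn ih
      obtain ⟨s, hs⟩ := hΓ.typed_lookup n hn
      obtain ⟨X, hX, hX'⟩ := trCtx_lookup hT.scoped_dot hΓ n hn hs
      exact .of_typed hT hs (typed_var n ih hX hX')
    · intro Γ A B s₁ s₂ s₃ hr hA hB ihA ihB
      have ihB := ihB.univ
      rw [trCtx_cons hA] at ihB
      exact .of_sort hT (hT.typed_prod_dot hr ihA.univ ihB)
    · intro Γ A B M s₁ s₂ s₃ hr hA hB hM ihA ihB ihM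
      have ihB := ihB.univ
      have ihM := ihM.2 _ hB
      rw [trCtx_cons hA] at ihB ihM
      exact .of_typed hT (.prod hr hA hB) (hT.typed_abs hr ihA.univ ihB ihM)
    · intro Γ A B M N s₁ s₂ s₃ hr hA hB hN hM ihA ihB ihN ihM
      have ihB := ihB.univ
      rw [trCtx_cons hA] at ihB
      refine .of_typed hT (hB.subst_single hN) ?_
      rw [tr_subst_single hT.scoped_dot]
      exact hT.typed_app hr ihA.univ ihB (ihM.2 _ (.prod hr hA hB)) (ihN.2 _ hA)
  refine ⟨fun h => ?_, key⟩
  cases h with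
  | empty => exact .empty
  | decl hA =>
    rw [trCtx_cons hA]
    exact .decl (hT.typed_el (key hA).univ)

end Soundness

end SEnc

/-- Soundness of the encoding with internalized sorts. -/
theorem mainTheorem9 {S : Type u} {K : Type v} {arK : K → ℕ} (P : EPTS.Spec S)
    (T : DK.Theory (SEnc.Const K) (SEnc.arity arK)) (dot : S → SEnc.Tm arK)
    (hT : SEnc.Represents P T dot) :
    (∀ Γ : List (EPTS.Term S), EPTS.WF P Γ → DK.WF T (SEnc.trCtx P dot Γ)) ∧
    (∀ (Γ : List (EPTS.Term S)) (M A : EPTS.Term S), EPTS.Typed P Γ M A →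
      (∀ s : S, A = .sort s → P.IsTop s →
        DK.Typed T (SEnc.trCtx P dot Γ) (SEnc.tr dot M) (SEnc.tU (dot s))) ∧
      ((¬ ∃ s : S, A = .sort s ∧ P.IsTop s) →
        (∃! s : S, EPTS.Typed P Γ A (.sort s)) ∧
        ∀ s : S, EPTS.Typed P Γ A (.sort s) →
          DK.Typed T (SEnc.trCtx P dot Γ) (SEnc.tr dot M)
            (SEnc.tEl (dot s) (SEnc.tr dot A)))) := by
  obtain ⟨hwf, hty⟩ := SEnc.sound hT
  refine ⟨fun Γ h => hwf h, fun Γ M A h =>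
    ⟨fun s hs _ => (hty h).1 s hs, fun hA => ⟨?_, (hty h).2⟩⟩⟩
  have : ∃ s, EPTS.Typed P Γ A (.sort s) := by
    rcases h.type_correct with ⟨s, rfl⟩ | h
    -- A sort without a type would be a top-sort, since any axiom for it would type it in `Γ`.
    · by_contra hs
      exact hA ⟨s, rfl, fun ⟨s', hs'⟩ => hs ⟨s', .sort h.wf hs'⟩⟩
    · exact h
  obtain ⟨s, hs⟩ := this
  exact ⟨s, hs, fun s' hs' => hs'.sort_unique hs⟩
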